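/- Let $0<\alpha<n$ be integers with $\frac n2\le\alpha<n$, and let $P=\sum_{|k|\le\alpha}a_kD^k$ be a differential operator on $\mathbb{R}^n$ of order exactly $\alpha$ with constant complex (in particular, possibly real) coefficients, where $D^k=\partial_1^{k_1}\cdots\partial_n^{k_n}$. Let $$p(\xi)=P(2\pi i\xi)=\sum_{|k|\le\alpha}a_k(2\pi i\xi)^k,\qquad p_\alpha(\xi)=(2\pi i)^\alpha\sum_{|k|=\alpha}a_k\xi^k .$$ Assume that $P$ is elliptic, i.e. $|p_\alpha(\xi)|\ge c_0|\xi|^\alpha$ for all $\xi\in\mathbb{R}^n$ and some $c_0>0$; that $P$ is not homogeneous, i.e. $a_k\ne0$ for some $k$ with $|k|<\alpha$; and that for some $c_1>0$ $$|p(\xi)|\ge c_1|\xi|^\alpha\qquad\text{for all }\xi\in\mathbb{R}^n .$$ Then $1/p$ is a locally integrable function defining a tempered distribution, and its inverse Fourier transform (normalised so that formally $K_P(x)=\int_{\mathbb{R}^n}e^{2\pi i x\cdot\xi}\,p(\xi)^{-1}\,d\xi$) is given by a locally integrable function $K_P$, unique up to null sets, which is a fundamental solution of $P$, i.e. $PK_P=\delta_0$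 in the sense of distributions. This fundamental solution satisfies $$K_P\in L^{\frac{n}{n-\alpha}}\big(\{x\in\mathbb{R}^n:|x|\ge1\}\big).$$ -/

import Mathlib

open MeasureTheory SchwartzMap LineDeriv FourierTransform

noncomputable section

namespace EllipticOperator

/-- Euclidean space `ℝⁿ`. -/
abbrev Space (n : ℕ) : Type := EuclideanSpace ℝ (Fin n)

/-- The differential monomial `D^k = ∂₁^{k₁} ⋯ ∂ₙ^{kₙ}` on tempered distributions. -/
def monomialDeriv {n : ℕ} (k : Fin n →₀ ℕ) (T : 𝓢'(Space n, ℂ)) : 𝓢'(Space n, ℂ) :=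
  (List.finRange n).foldr
    (fun i S => (fun U : 𝓢'(Space n, ℂ) => ∂_{EuclideanSpace.single i (1 : ℝ)} U)^[k i] S) T

/-- The constant-coefficient operator `P = ∑ₖ aₖ D^k`, encoded by the polynomial
`∑ₖ aₖ X^k`, acting on tempered distributions. Its order is the total degree of the polynomial. -/
def applyOp {n : ℕ} (P : MvPolynomial (Fin n) ℂ) (T : 𝓢'(Space n, ℂ)) : 𝓢'(Space n, ℂ) :=
  ∑ k ∈ P.support, P.coeff k • monomialDeriv k T

/-- The total symbol `p(ξ) = P(2πiξ) = ∑ₖ aₖ (2πiξ)^k`. -/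
def symbol {n : ℕ} (P : MvPolynomial (Fin n) ℂ) (ξ : Space n) : ℂ :=
  MvPolynomial.eval (fun j => 2 * (Real.pi : ℂ) * Complex.I * ((ξ j : ℝ) : ℂ)) P

/-- The strictly homogeneous principal symbol of an operator of order `α`:
`p_α(ξ) = (2πi)^α ∑_{|k| = α} aₖ ξ^k`. -/
def principalSymbol {n : ℕ} (P : MvPolynomial (Fin n) ℂ) (α : ℕ) (ξ : Space n) : ℂ :=
  symbol (MvPolynomial.homogeneousComponent α P) ξ

/-- Ellipticity of an operator of order `α`: `|p_α(ξ)| ≥ c₀ |ξ|^α` for some `c₀ > 0`. -/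
def IsElliptic {n : ℕ} (P : MvPolynomial (Fin n) ℂ) (α : ℕ) : Prop :=
  ∃ c₀ : ℝ, 0 < c₀ ∧ ∀ ξ : Space n, c₀ * ‖ξ‖ ^ α ≤ ‖principalSymbol P α ξ‖

/-- The tempered distribution `T` is the locally integrable function `f`. -/
def IsGivenBy {n : ℕ} (T : 𝓢'(Space n, ℂ)) (f : Space n → ℂ) : Prop :=
  LocallyIntegrable f volume ∧
    ∀ φ : 𝓢(Space n, ℂ), Integrable (fun x => φ x * f x) volume ∧ T φ = ∫ x, φ x * f x

/-- `K` is (a representative of) the fundamental solution `K_P` of `P`: a locally integrable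
function which, as a tempered distribution, satisfies `P K = δ₀` and is the inverse Fourier
transform of the function `1 / p`. The Fourier condition determines `K` almost everywhere. -/
def IsFundamentalSolution {n : ℕ} (P : MvPolynomial (Fin n) ℂ) (K : Space n → ℂ) : Prop :=
  ∃ T : 𝓢'(Space n, ℂ), IsGivenBy T K ∧
    applyOp P T = TemperedDistribution.delta 0 ∧
    IsGivenBy (𝓕 T) (fun ξ => (symbol P ξ)⁻¹)

end EllipticOperator

end

/-! Split `1/p = χ/p + (1 - χ)/p` with a smooth cutoff `χ` equal to 1 near the origin and supported
in the unit ball. The high-frequency part contributes an integrable function that is bounded on `|x|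
≥ 1`, hence lies in every `L^q` there with `1 ≤ q < ∞`. To see this, cut `(1 - χ)/p` into dyadic
shells and rescale each to unit size. Ellipticity keeps the rescaled pieces smooth down to the limit
`t = 0`, so they are bounded in the Schwartz space and the pieces of the kernel sum like `2^{-jα}`
(`exists_integrable_fourier_eq_high`).

For the low frequencies, Hausdorff–Young (`memLp_fourierInv`) reduces the claim to `χ/p ∈ L^{n/α}`.
The exponents `n/α` and `n/(n-α)` are conjugate, and `n/α ≤ 2` because `α ≥ n/2`. The bound `|p| ≥
c₁|ξ|^α` alone gives only `|ξ|^{-n}`, which diverges logarithmically. Non-homogeneity removes the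
divergence: if `Q` is the nonzero homogeneous part of least degree `m < α`, then on the shell of
radius about `t` one also has `|p(tη)| ≥ c t^{α-1}|Q(η)|`. Interpolating with a small power `δ`
gains a factor `t^δ`, at the price of `|Q|^{-δ}`, which is locally integrable for small `δ`
(`lintegral_ball_symbol_rpow_lt_top`). The dyadic sum is then geometric
(`lintegral_ball_symbol_rpow_neg_lt_top`).

The equation `P K = δ₀` becomes `p · (1/p) = 1` under the Fourier transform, and the same transform
determines `K` almost everywhere. -/

namespace EllipticOperator

open scoped ENNReal ContDiff

/-! ### Plancherel and Hausdorff–Young for integrable functions. -/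

section Fourier

variable {V : Type*} [NormedAddCommGroup V] [InnerProductSpace ℝ V] [FiniteDimensional ℝ V]
  [MeasurableSpace V] [BorelSpace V]

/-- The Fourier transform of an integrable function is self-adjoint against Schwartz functions. -/
theorem integral_fourier_schwartz_mul {f : V → ℂ} (hf : Integrable f) (φ : 𝓢(V, ℂ)) :
    ∫ x, (𝓕 φ : 𝓢(V, ℂ)) x * f x = ∫ x, φ x * 𝓕 f x := by
  have := VectorFourier.integral_fourierIntegral_smul_eq_flip (L := innerₗ V)
    (μ := volume) (ν := volume) Real.continuous_fourierChar continuous_inner φ.integrable hf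
  simpa only [flip_innerₗ, smul_eq_mul] using! this

theorem continuous_fourier_of_integrable {f : V → ℂ} (hf : Integrable f) : Continuous (𝓕 f) :=
  VectorFourier.fourierIntegral_continuous Real.continuous_fourierChar continuous_inner hf

/-- Two locally integrable functions with the same pairings against Schwartz functions are
almost everywhere equal. -/
theorem ae_eq_of_integral_schwartz_mul_eq {f g : V → ℂ} (hf : LocallyIntegrable f)
    (hg : LocallyIntegrable g) (h : ∀ φ : 𝓢(V, ℂ), ∫ x, φ x * f x = ∫ x, φ x * g x) :
    f =ᵐ[volume] g := by
  refine ae_eq_of_integral_contDiff_smul_eq hf hg fun u hu hsupp => ?_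
  have hu' : ContDiff ℝ ∞ (fun x => (u x : ℂ)) := Complex.ofRealCLM.contDiff.comp hu
  have hs' : HasCompactSupport (fun x => (u x : ℂ)) :=
    hsupp.comp_left (g := fun y : ℝ => (y : ℂ)) (by simp)
  simpa using! h (hs'.toSchwartzMap hu')

/-- Plancherel's theorem on `L¹ ∩ L²`. -/
theorem lintegral_enorm_sq_fourier_le {f : V → ℂ} (hf : Integrable f) :
    ∫⁻ x, ‖𝓕 f x‖ₑ ^ 2 ≤ ∫⁻ x, ‖f x‖ₑ ^ 2 := by
  have key (g : V → ℂ) : eLpNorm g 2 volume ^ 2 = ∫⁻ x, ‖g x‖ₑ ^ 2 := by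
    rw [eLpNorm_eq_lintegral_rpow_enorm_toReal (by norm_num) (by norm_num), ← ENNReal.rpow_two,
      ← ENNReal.rpow_mul]
    simp
  by_cases h2 : MemLp f 2 volume
  · set F : Lp ℂ 2 (volume : Measure V) := h2.toLp f
    -- The `L²` transform and the integral transform represent the same tempered distribution, so
    -- they agree almost everywhere.
    have h𝓕 : (𝓕 F : Lp ℂ 2 (volume : Measure V)) =ᵐ[volume] 𝓕 f := by
      refine ae_eq_of_integral_schwartz_mul_eq
        ((Lp.memLp (𝓕 F)).locallyIntegrable (by norm_num))
        (continuous_fourier_of_integrable hf).locallyIntegrable fun φ => ?_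
      have h1 := congr($(Lp.fourier_toTemperedDistribution_eq F) φ)
      simp only [TemperedDistribution.fourier_apply, Lp.toTemperedDistribution_apply,
        smul_eq_mul] at h1
      rw [← h1, ← integral_fourier_schwartz_mul hf]
      refine integral_congr_ae ?_
      filter_upwards [h2.coeFn_toLp] with x hx
      rw [hx]
    rw [← key, ← key, ← eLpNorm_congr_ae h𝓕, ← eLpNorm_congr_ae h2.coeFn_toLp]
    have := Lp.norm_fourier_eq F
    rw [Lp.norm_def, Lp.norm_def,
      ENNReal.toReal_eq_toReal_iff' (Lp.memLp _).2.ne (Lp.memLp _).2.ne] at this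
    rw [this]
  · have : eLpNorm f 2 volume = ⊤ := by
      by_contra hne
      exact h2 ⟨hf.aestronglyMeasurable, lt_top_iff_ne_top.2 hne⟩
    rw [← key f, this]
    simp

theorem enorm_fourier_le_lintegral (f : V → ℂ) (x : V) : ‖𝓕 f x‖ₑ ≤ ∫⁻ y, ‖f y‖ₑ := by
  rw [Real.fourier_eq]
  refine (enorm_integral_le_lintegral_enorm _).trans_eq (lintegral_congr fun y => ?_)
  simp [← ofReal_norm]

theorem fourier_add_of_integrable {f g : V → ℂ} (hf : Integrable f) (hg : Integrable g) (x : V) :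
    𝓕 (fun y => f y + g y) x = 𝓕 f x + 𝓕 g x := by
  simp only [Real.fourier_eq, smul_add]
  exact integral_add ((Real.fourierIntegral_convergent_iff x).2 hf)
    ((Real.fourierIntegral_convergent_iff x).2 hg)

/-- The Marcinkiewicz splitting at a height depending on `t`. Where `f` is large, `|f| ≤ (t /
2A)|f|^p`, so that part has transform at most `t/2` everywhere. The remaining part must exceed
`t/2`, and Chebyshev with Plancherel bounds the measure. -/
theorem measure_lt_norm_fourier_le {f : V → ℂ} (hfm : Measurable f) (hf : Integrable f)
    {p A t : ℝ} (hp : 1 < p) (hA : 0 < A) (hfp : ∫⁻ x, ENNReal.ofReal (‖f x‖ ^ p) ≤ ENNReal.ofReal A)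
    (ht : 0 < t) :
    volume {x | t < ‖𝓕 f x‖} ≤ ENNReal.ofReal (4 * t ^ (-2 : ℝ)) *
      ∫⁻ x, {x | t * ‖f x‖ ^ (p - 1) ≤ 2 * A}.indicator (fun x => ‖f x‖ₑ ^ 2) x := by
  set S : Set V := {x | t * ‖f x‖ ^ (p - 1) ≤ 2 * A} with hS
  have hSm : MeasurableSet S := measurableSet_le (by fun_prop) measurable_const
  have h1 : Integrable (Sᶜ.indicator f) := hf.indicator hSm.compl
  have h2 : Integrable (S.indicator f) := hf.indicator hSm
  have hsum (x : V) : 𝓕 f x = 𝓕 (S.indicator f) x + 𝓕 (Sᶜ.indicator f) x := by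
    rw [← fourier_add_of_integrable h2 h1]
    refine congrArg (fun h : V → ℂ => 𝓕 h x) (funext fun y => ?_)
    exact (Set.indicator_self_add_compl_apply S f y).symm
  have hlarge (x : V) : ‖𝓕 (Sᶜ.indicator f) x‖ ≤ t / 2 := by
    rw [← ENNReal.ofReal_le_ofReal_iff (by positivity), ofReal_norm]
    calc ‖𝓕 (Sᶜ.indicator f) x‖ₑ ≤ ∫⁻ y, ‖Sᶜ.indicator f y‖ₑ := enorm_fourier_le_lintegral _ _
      _ ≤ ∫⁻ y, ENNReal.ofReal (t / (2 * A)) * ENNReal.ofReal (‖f y‖ ^ p) := by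
        refine lintegral_mono fun y => ?_
        by_cases hy : y ∈ S
        · simp [hy]
        · rw [Set.indicator_of_mem (Set.mem_compl hy), ← ofReal_norm,
            ← ENNReal.ofReal_mul (by positivity)]
          refine ENNReal.ofReal_le_ofReal ?_
          have hlt : 2 * A < t * ‖f y‖ ^ (p - 1) := not_le.1 hy
          have hpos : 0 < ‖f y‖ := by
            refine (norm_nonneg _).lt_of_ne fun h0 => ?_
            rw [← h0, Real.zero_rpow (by linarith)] at hlt
            linarith
          have hp' : ‖f y‖ ^ p = ‖f y‖ ^ (p - 1) * ‖f y‖ := by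
            rw [← Real.rpow_add_one hpos.ne']
            ring_nf
          rw [hp', div_mul_eq_mul_div, le_div_iff₀ (by positivity)]
          nlinarith
      _ = ENNReal.ofReal (t / (2 * A)) * ∫⁻ y, ENNReal.ofReal (‖f y‖ ^ p) :=
        lintegral_const_mul _ (by fun_prop)
      _ ≤ ENNReal.ofReal (t / (2 * A)) * ENNReal.ofReal A := by gcongr
      _ = ENNReal.ofReal (t / 2) := by
        rw [← ENNReal.ofReal_mul (by positivity)]
        congr 1
        field_simp
  have hsub : {x | t < ‖𝓕 f x‖} ⊆
      {x | ENNReal.ofReal ((t / 2) ^ 2) ≤ ‖𝓕 (S.indicator f) x‖ₑ ^ 2} := fun x hx => by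
    have hx : t < ‖𝓕 f x‖ := hx
    have h3 : t / 2 ≤ ‖𝓕 (S.indicator f) x‖ := by
      have := norm_add_le (𝓕 (S.indicator f) x) (𝓕 (Sᶜ.indicator f) x)
      rw [← hsum] at this
      linarith [hlarge x]
    simp only [Set.mem_ofPred_eq]
    rw [← ofReal_norm, ← ENNReal.ofReal_pow (norm_nonneg _)]
    gcongr
  refine (measure_mono hsub).trans ?_
  refine (meas_ge_le_lintegral_div ?_ (by positivity) ENNReal.ofReal_ne_top).trans ?_
  · exact ((continuous_fourier_of_integrable h2).measurable.enorm.pow_const 2).aemeasurable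
  · have h4 : (ENNReal.ofReal ((t / 2) ^ 2))⁻¹ = ENNReal.ofReal (4 * t ^ (-2 : ℝ)) := by
      rw [← ENNReal.ofReal_inv_of_pos (by positivity), Real.rpow_neg ht.le, Real.rpow_two]
      congr 1
      field_simp
      norm_num
    rw [ENNReal.div_eq_inv_mul, h4]
    refine mul_le_mul_right ?_ _
    refine (lintegral_enorm_sq_fourier_le h2).trans_eq (lintegral_congr fun x => ?_)
    by_cases hx : x ∈ S <;> simp [hx]

theorem lintegral_Ioc_rpow {r L : ℝ} (hr : -1 < r) (hL : 0 ≤ L) :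
    ∫⁻ t in Set.Ioc 0 L, ENNReal.ofReal (t ^ r) = ENNReal.ofReal (L ^ (r + 1) / (r + 1)) := by
  rw [← ofReal_integral_eq_lintegral_ofReal, ← intervalIntegral.integral_of_le hL,
    integral_rpow (Or.inl hr), Real.zero_rpow (by linarith), sub_zero]
  · exact (intervalIntegrable_iff_integrableOn_Ioc_of_le hL).1
      (intervalIntegral.intervalIntegrable_rpow' hr)
  · filter_upwards [ae_restrict_mem measurableSet_Ioc] with t ht
    exact Real.rpow_nonneg ht.1.le _

/-- The **Hausdorff–Young inequality**, in qualitative form, for exponents `1 < p < 2`. -/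
theorem lintegral_fourier_rpow_lt_top {f : V → ℂ} (hfm : Measurable f) (hf : Integrable f)
    {p q : ℝ} (hpq : p.HolderConjugate q) (hp2 : p < 2)
    (hfp : ∫⁻ x, ENNReal.ofReal (‖f x‖ ^ p) < ⊤) :
    ∫⁻ x, ENNReal.ofReal (‖𝓕 f x‖ ^ q) < ⊤ := by
  have hp1 : 1 < p := hpq.lt
  have hq : (p - 1) * (q - 1) = 1 := by
    have := hpq.mul_eq_add
    linarith
  have hq2 : 2 < q := by nlinarith
  -- The added 1 makes `A` positive even when `f` vanishes almost everywhere.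
  set A : ℝ := (∫⁻ x, ENNReal.ofReal (‖f x‖ ^ p)).toReal + 1 with hA
  have hA0 : 0 < A := by positivity
  have hfA : ∫⁻ x, ENNReal.ofReal (‖f x‖ ^ p) ≤ ENNReal.ofReal A :=
    ENNReal.le_ofReal_iff_toReal_le hfp.ne hA0.le |>.2 (by simp [hA])
  rw [lintegral_rpow_eq_lintegral_meas_lt_mul volume (.of_forall fun x => norm_nonneg _)
    (continuous_fourier_of_integrable hf).norm.measurable.aemeasurable (by linarith)]
  refine ENNReal.mul_lt_top ENNReal.ofReal_lt_top ?_
  let H : ℝ → V → ℝ≥0∞ := fun t x => ENNReal.ofReal (4 * t ^ (q - 3)) *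
    {x | t * ‖f x‖ ^ (p - 1) ≤ 2 * A}.indicator (fun x => ‖f x‖ₑ ^ 2) x
  have hHm : Measurable (Function.uncurry H) := by
    refine Measurable.mul (by fun_prop) ?_
    have : MeasurableSet {z : ℝ × V | z.1 * ‖f z.2‖ ^ (p - 1) ≤ 2 * A} :=
      measurableSet_le (by fun_prop) measurable_const
    exact Measurable.indicator (f := fun z : ℝ × V => ‖f z.2‖ₑ ^ 2) (by fun_prop) this
  set C : ℝ := 4 * ((2 * A) ^ (q - 2) / (q - 2)) with hC
  -- For fixed `x` only `t ≤ L = 2A / |f x|^{p-1}` contributes. The power `t^{q-3}` is integrable at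
  -- 0 since `q > 2`, and `(p-1)(q-2) = 2-p` turns `|f|² L^{q-2}` into a multiple of `|f|^p`.
  have hpoint (x : V) : ∫⁻ t in Set.Ioi 0, H t x ≤ ENNReal.ofReal C * ENNReal.ofReal (‖f x‖ ^ p) := by
    rcases eq_or_ne (f x) 0 with h0 | h0
    · simp [H, h0, Set.indicator]
    have hpos : 0 < ‖f x‖ := norm_pos_iff.2 h0
    set L : ℝ := 2 * A / ‖f x‖ ^ (p - 1) with hL
    have hL0 : 0 < L := by positivity
    calc ∫⁻ t in Set.Ioi 0, H t x
        ≤ ∫⁻ t in Set.Ioi 0, (Set.Ioc 0 L).indicator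
            (fun t => ENNReal.ofReal (4 * ‖f x‖ ^ 2) * ENNReal.ofReal (t ^ (q - 3))) t := by
          refine setLIntegral_mono' measurableSet_Ioi fun t ht => ?_
          have ht : 0 < t := ht
          by_cases hmem : t * ‖f x‖ ^ (p - 1) ≤ 2 * A
          · have htL : t ∈ Set.Ioc 0 L := ⟨ht, (le_div_iff₀ (by positivity)).2 hmem⟩
            simp only [H, htL, Set.indicator, Set.mem_ofPred_eq, hmem, if_true]
            rw [← ofReal_norm, ← ENNReal.ofReal_pow (norm_nonneg _),
              ← ENNReal.ofReal_mul (by positivity), ← ENNReal.ofReal_mul (by positivity)]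
            refine ENNReal.ofReal_le_ofReal (le_of_eq (by ring))
          · simp [H, hmem, Set.indicator]
      _ ≤ ∫⁻ t, (Set.Ioc 0 L).indicator
            (fun t => ENNReal.ofReal (4 * ‖f x‖ ^ 2) * ENNReal.ofReal (t ^ (q - 3))) t :=
          setLIntegral_le_lintegral _ _
      _ = ENNReal.ofReal (4 * ‖f x‖ ^ 2) * ENNReal.ofReal (L ^ (q - 2) / (q - 2)) := by
          rw [lintegral_indicator measurableSet_Ioc, lintegral_const_mul _ (by fun_prop),
            lintegral_Ioc_rpow (by linarith) hL0.le]
          ring_nf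
      _ = ENNReal.ofReal C * ENNReal.ofReal (‖f x‖ ^ p) := by
          rw [← ENNReal.ofReal_mul (by positivity), ← ENNReal.ofReal_mul
            (by have : 0 < q - 2 := by linarith
                positivity)]
          congr 1
          have h5 : ‖f x‖ ^ (2 : ℝ) = ‖f x‖ ^ p * (‖f x‖ ^ (p - 1)) ^ (q - 2) := by
            rw [← Real.rpow_mul hpos.le, ← Real.rpow_add hpos]
            congr 1
            nlinarith
          have h6 : 0 < (‖f x‖ ^ (p - 1)) ^ (q - 2) := by positivity
          have h7 : q - 2 ≠ 0 := by linarith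
          rw [hL, Real.div_rpow (by positivity) (by positivity), ← Real.rpow_two, h5, hC]
          field_simp
  calc ∫⁻ t in Set.Ioi 0, volume {x | t < ‖𝓕 f x‖} * ENNReal.ofReal (t ^ (q - 1))
      ≤ ∫⁻ t in Set.Ioi 0, ∫⁻ x, H t x := by
        refine setLIntegral_mono' measurableSet_Ioi fun t ht => ?_
        have ht : 0 < t := ht
        have hm : Measurable ({x | t * ‖f x‖ ^ (p - 1) ≤ 2 * A}.indicator
            (fun x => ‖f x‖ₑ ^ 2)) :=
          Measurable.indicator (by fun_prop) (measurableSet_le (by fun_prop) measurable_const)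
        rw [lintegral_const_mul _ hm]
        refine (mul_le_mul_left (measure_lt_norm_fourier_le hfm hf hp1 hA0 hfA ht) _).trans_eq ?_
        rw [mul_right_comm, ← ENNReal.ofReal_mul (by positivity), mul_assoc 4, ← Real.rpow_add ht]
        ring_nf
    _ = ∫⁻ x, ∫⁻ t in Set.Ioi 0, H t x := lintegral_lintegral_swap hHm.aemeasurable
    _ ≤ ∫⁻ x, ENNReal.ofReal C * ENNReal.ofReal (‖f x‖ ^ p) := lintegral_mono hpoint
    _ = ENNReal.ofReal C * ∫⁻ x, ENNReal.ofReal (‖f x‖ ^ p) := lintegral_const_mul _ (by fun_prop)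
    _ < ⊤ := ENNReal.mul_lt_top ENNReal.ofReal_lt_top hfp

/-- The **Hausdorff–Young inequality**, in qualitative form. -/
theorem memLp_fourier {f : V → ℂ} (hfm : Measurable f) (hf : Integrable f)
    {p q : ℝ} (hpq : p.HolderConjugate q) (hp2 : p ≤ 2)
    (hfp : ∫⁻ x, ENNReal.ofReal (‖f x‖ ^ p) < ⊤) :
    MemLp (𝓕 f) (ENNReal.ofReal q) volume := by
  have hq0 : 0 < q := hpq.symm.pos
  refine ⟨(continuous_fourier_of_integrable hf).aestronglyMeasurable, ?_⟩
  rw [eLpNorm_lt_top_iff_lintegral_rpow_enorm_lt_top (by simpa using hq0) (by simp),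
    ENNReal.toReal_ofReal hq0.le]
  have hconv (g : V → ℂ) {r : ℝ} (hr : 0 ≤ r) :
      ∫⁻ x, ENNReal.ofReal (‖g x‖ ^ r) = ∫⁻ x, ‖g x‖ₑ ^ r := by
    refine lintegral_congr fun x => ?_
    rw [← ofReal_norm, ENNReal.ofReal_rpow_of_nonneg (norm_nonneg _) hr]
  rw [hconv f hpq.nonneg] at hfp
  rcases hp2.lt_or_eq with h | rfl
  · rw [← hconv _ hq0.le]
    exact lintegral_fourier_rpow_lt_top hfm hf hpq h (by rwa [hconv f hpq.nonneg])
  · have hq2 : q = 2 := by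
      have := hpq.mul_eq_add
      linarith
    subst hq2
    simp only [ENNReal.rpow_two] at hfp ⊢
    exact (lintegral_enorm_sq_fourier_le hf).trans_lt hfp

/-- The **Hausdorff–Young inequality** for the inverse Fourier transform. -/
theorem memLp_fourierInv {f : V → ℂ} (hfm : Measurable f) (hf : Integrable f)
    {p q : ℝ} (hpq : p.HolderConjugate q) (hp2 : p ≤ 2)
    (hfp : ∫⁻ x, ENNReal.ofReal (‖f x‖ ^ p) < ⊤) :
    MemLp (𝓕⁻ f) (ENNReal.ofReal q) volume := by
  rw [Real.fourierInv_eq_fourier_comp_neg]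
  refine memLp_fourier (hfm.comp measurable_neg) hf.comp_neg hpq hp2 ?_
  simpa only [Function.comp_apply, lintegral_neg_eq_self (fun x => ENNReal.ofReal (‖f x‖ ^ p))]

end Fourier

/-! ### Constant-coefficient operators as Fourier multipliers. -/

section Distributions

variable {n : ℕ}

theorem fourier_lineDeriv_single (i : Fin n) (T : 𝓢'(Space n, ℂ)) :
    𝓕 (∂_{EuclideanSpace.single i (1 : ℝ)} T) = TemperedDistribution.smulLeftCLM ℂ
      (fun ξ : Space n => 2 * (Real.pi : ℂ) * Complex.I * ((ξ i : ℝ) : ℂ)) (𝓕 T) := by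
  rw [TemperedDistribution.fourier_lineDerivOp_eq]
  have hg : (fun ξ : Space n => ((inner ℝ ξ (EuclideanSpace.single i (1 : ℝ)) : ℝ) : ℂ)).HasTemperateGrowth := by
    fun_prop
  have := congr($(TemperedDistribution.smulLeftCLM_smul (F := ℂ) hg
    (2 * (Real.pi : ℂ) * Complex.I)) (𝓕 T))
  refine (Eq.trans ?_ this.symm).trans ?_
  · rfl
  congr 2
  ext ξ
  simp [EuclideanSpace.inner_single_right]

theorem hasTemperateGrowth_coordinate (i : Fin n) :
    (fun ξ : Space n => 2 * (Real.pi : ℂ) * Complex.I * ((ξ i : ℝ) : ℂ)).HasTemperateGrowth := by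
  have h : (fun ξ : Space n => ξ i).HasTemperateGrowth :=
    (EuclideanSpace.proj (𝕜 := ℝ) i).hasTemperateGrowth
  fun_prop

theorem hasTemperateGrowth_prod_pow (k : Fin n →₀ ℕ) (l : List (Fin n)) :
    (fun ξ : Space n => (l.map fun i =>
      (2 * (Real.pi : ℂ) * Complex.I * ((ξ i : ℝ) : ℂ)) ^ k i).prod).HasTemperateGrowth := by
  induction l with
  | nil => simp
  | cons i l ih =>
    simp only [List.map_cons, List.prod_cons]
    exact ((hasTemperateGrowth_coordinate i).pow _).mul ih

theorem fourier_iterate_lineDeriv_single (i : Fin n) (N : ℕ) (T : 𝓢'(Space n, ℂ)) :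
    𝓕 ((fun U : 𝓢'(Space n, ℂ) => ∂_{EuclideanSpace.single i (1 : ℝ)} U)^[N] T) =
      TemperedDistribution.smulLeftCLM ℂ
        (fun ξ : Space n => (2 * (Real.pi : ℂ) * Complex.I * ((ξ i : ℝ) : ℂ)) ^ N) (𝓕 T) := by
  induction N with
  | zero => simp
  | succ N ih =>
    rw [Function.iterate_succ_apply', fourier_lineDeriv_single, ih]
    exact TemperedDistribution.smulLeftCLM_smulLeftCLM_apply
      ((hasTemperateGrowth_coordinate i).pow N) (hasTemperateGrowth_coordinate i) _

theorem fourier_monomialDeriv (k : Fin n →₀ ℕ) (T : 𝓢'(Space n, ℂ)) :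
    𝓕 (monomialDeriv k T) = TemperedDistribution.smulLeftCLM ℂ
      (fun ξ : Space n => ∏ i, (2 * (Real.pi : ℂ) * Complex.I * ((ξ i : ℝ) : ℂ)) ^ k i)
      (𝓕 T) := by
  have key (l : List (Fin n)) : 𝓕 (l.foldr
      (fun i S => (fun U : 𝓢'(Space n, ℂ) => ∂_{EuclideanSpace.single i (1 : ℝ)} U)^[k i] S) T) =
      TemperedDistribution.smulLeftCLM ℂ (fun ξ : Space n => (l.map fun i =>
        (2 * (Real.pi : ℂ) * Complex.I * ((ξ i : ℝ) : ℂ)) ^ k i).prod) (𝓕 T) := by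
    induction l with
    | nil => simp
    | cons i l ih =>
      rw [List.foldr_cons, fourier_iterate_lineDeriv_single, ih]
      refine (TemperedDistribution.smulLeftCLM_smulLeftCLM_apply (hasTemperateGrowth_prod_pow k l)
        ((hasTemperateGrowth_coordinate i).pow _) _).trans ?_
      congr 2
      ext ξ
      simp [mul_comm]
  have h := key (List.finRange n)
  simp only [← List.ofFn_eq_map, List.prod_ofFn] at h
  exact h

theorem symbol_eq_sum (P : MvPolynomial (Fin n) ℂ) (ξ : Space n) : symbol P ξ =
    ∑ k ∈ P.support, P.coeff k * ∏ i, (2 * (Real.pi : ℂ) * Complex.I * ((ξ i : ℝ) : ℂ)) ^ k i :=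
  MvPolynomial.eval_eq' _ _

theorem hasTemperateGrowth_monomial (k : Fin n →₀ ℕ) :
    (fun ξ : Space n => ∏ i, (2 * (Real.pi : ℂ) * Complex.I *
      ((ξ i : ℝ) : ℂ)) ^ k i).HasTemperateGrowth := by
  simpa only [← List.ofFn_eq_map, List.prod_ofFn] using
    hasTemperateGrowth_prod_pow k (List.finRange n)

theorem hasTemperateGrowth_symbol (P : MvPolynomial (Fin n) ℂ) :
    (symbol P).HasTemperateGrowth := by
  have : symbol P = fun ξ => ∑ k ∈ P.support, P.coeff k *
      ∏ i, (2 * (Real.pi : ℂ) * Complex.I * ((ξ i : ℝ) : ℂ)) ^ k i := funext (symbol_eq_sum P)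
  rw [this]
  exact .sum fun k _ => (Function.HasTemperateGrowth.const _).mul (hasTemperateGrowth_monomial k)

/-- On the Fourier side a constant-coefficient operator is multiplication by its symbol. -/
theorem fourier_applyOp (P : MvPolynomial (Fin n) ℂ) (T : 𝓢'(Space n, ℂ)) :
    𝓕 (applyOp P T) = TemperedDistribution.smulLeftCLM ℂ (symbol P) (𝓕 T) := by
  have hsum : symbol P = fun ξ => ∑ k ∈ P.support, (P.coeff k • fun ξ : Space n =>
      ∏ i, (2 * (Real.pi : ℂ) * Complex.I * ((ξ i : ℝ) : ℂ)) ^ k i) ξ := by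
    ext ξ
    simpa using symbol_eq_sum P ξ
  have htg (k) (_ : k ∈ P.support) : (P.coeff k • fun ξ : Space n =>
      ∏ i, (2 * (Real.pi : ℂ) * Complex.I * ((ξ i : ℝ) : ℂ)) ^ k i).HasTemperateGrowth :=
    (Function.HasTemperateGrowth.const (P.coeff k)).mul (hasTemperateGrowth_monomial k)
  rw [hsum, TemperedDistribution.smulLeftCLM_sum htg]
  have hlin := map_sum (fourierCLM ℂ 𝓢'(Space n, ℂ))
    (fun k => P.coeff k • monomialDeriv k T) P.support
  simp only [fourierCLM_apply] at hlin
  rw [applyOp, hlin, sum_apply]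
  refine Finset.sum_congr rfl fun k _ => ?_
  rw [FourierTransform.fourier_smul, fourier_monomialDeriv,
    TemperedDistribution.smulLeftCLM_smul (hasTemperateGrowth_monomial k), smul_apply]

/-- If `𝓕 T = 1 / p` and `p ≠ 0` almost everywhere, then `P T = δ₀`. -/
theorem applyOp_eq_delta {P : MvPolynomial (Fin n) ℂ} {T : 𝓢'(Space n, ℂ)}
    (hT : IsGivenBy (𝓕 T) fun ξ => (symbol P ξ)⁻¹) (hP : ∀ᵐ ξ : Space n, symbol P ξ ≠ 0) :
    applyOp P T = TemperedDistribution.delta 0 := by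
  have hinj : Function.Injective (fun U : 𝓢'(Space n, ℂ) => 𝓕 U) :=
    Function.LeftInverse.injective (g := fun U => 𝓕⁻ U) fun U => fourierInv_fourier_eq U
  refine hinj ?_
  simp only
  rw [fourier_applyOp, TemperedDistribution.fourier_delta_zero]
  ext φ
  rw [TemperedDistribution.smulLeftCLM_apply_apply, (hT.2 _).2]
  refine Eq.trans ?_ (Measure.toTemperedDistribution_apply volume φ).symm
  refine integral_congr_ae ?_
  filter_upwards [hP] with ξ hξ
  rw [SchwartzMap.smulLeftCLM_apply_apply (hasTemperateGrowth_symbol P), smul_eq_mul]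
  field_simp

/-- The representative of a fundamental solution is determined almost everywhere. -/
theorem IsFundamentalSolution.ae_eq {P : MvPolynomial (Fin n) ℂ} {K L : Space n → ℂ}
    (hK : IsFundamentalSolution P K) (hL : IsFundamentalSolution P L) : K =ᵐ[volume] L := by
  obtain ⟨T, hT, -, hT'⟩ := hK
  obtain ⟨U, hU, -, hU'⟩ := hL
  have h𝓕 : 𝓕 T = 𝓕 U := by
    ext φ
    rw [(hT'.2 φ).2, (hU'.2 φ).2]
  have hTU : T = U := by
    rw [← FourierTransform.fourierInv_fourier_eq (F := 𝓢'(Space n, ℂ)) T, h𝓕,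
      FourierTransform.fourierInv_fourier_eq]
  subst hTU
  exact ae_eq_of_integral_schwartz_mul_eq hT.1 hU.1 fun φ => by rw [← (hT.2 φ).2, (hU.2 φ).2]

end Distributions

/-! ### Local integrability of small negative powers of a polynomial. -/

section Sublevel

-- The top coefficient involves only the slopes `b`. Restricted to a line, a homogeneous polynomial
-- therefore has a leading coefficient depending on the direction alone.
open Polynomial in
theorem coeff_prod_linear_pow {ι : Type*} (s : Finset ι) (a b : ι → ℂ) (k : ι → ℕ) :
    (∏ i ∈ s, (C (a i) + C (b i) * X) ^ k i).natDegree ≤ ∑ i ∈ s, k i ∧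
      (∏ i ∈ s, (C (a i) + C (b i) * X) ^ k i).coeff (∑ i ∈ s, k i) = ∏ i ∈ s, b i ^ k i := by
  classical
  have hlin (i : ι) : (C (a i) + C (b i) * X).natDegree ≤ 1 := by compute_degree
  have hpow (i : ι) : ((C (a i) + C (b i) * X) ^ k i).natDegree ≤ k i := by
    simpa using natDegree_pow_le_of_le (k i) (hlin i)
  have hcoeff (i : ι) : ((C (a i) + C (b i) * X) ^ k i).coeff (k i) = b i ^ k i := by
    have := coeff_pow_of_natDegree_le (m := k i) (hlin i)
    rw [mul_one] at this
    simpa using this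
  induction s using Finset.induction_on with
  | empty => simp
  | insert i s hi ih =>
    rw [Finset.prod_insert hi, Finset.sum_insert hi, Finset.prod_insert hi]
    refine ⟨natDegree_mul_le_of_le (hpow i) ih.1, ?_⟩
    rw [coeff_mul_add_eq_of_natDegree_le (hpow i) ih.1, hcoeff, ih.2]

variable {n : ℕ}

/-- Along a line, a homogeneous symbol is a polynomial whose leading coefficient does not depend
on the base point. -/
theorem exists_polynomial_symbol_line {Q : MvPolynomial (Fin n) ℂ} {m : ℕ} (hQ : Q.IsHomogeneous m)
    (y v : Space n) (hv : symbol Q v ≠ 0) :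
    ∃ R : Polynomial ℂ, R.natDegree = m ∧ R.leadingCoeff = symbol Q v ∧
      ∀ s : ℝ, R.eval (s : ℂ) = symbol Q (y + s • v) := by
  set c : ℂ := 2 * (Real.pi : ℂ) * Complex.I
  set R : Polynomial ℂ := ∑ k ∈ Q.support, Polynomial.C (Q.coeff k) *
    ∏ i, (Polynomial.C (c * (y i : ℂ)) + Polynomial.C (c * (v i : ℂ)) * Polynomial.X) ^ k i with hR
  have hk (k) (hk : k ∈ Q.support) : ∑ i, k i = m := by
    rw [hQ.degree_eq_sum_deg_support hk]
    exact (Finset.sum_subset (Finset.subset_univ _) (by simp)).symm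
  have hdeg : R.natDegree ≤ m := by
    refine Polynomial.natDegree_sum_le_of_forall_le _ _ fun k hks => ?_
    refine (Polynomial.natDegree_C_mul_le _ _).trans ?_
    rw [← hk k hks]
    exact (coeff_prod_linear_pow _ _ _ _).1
  have hcoeff : R.coeff m = symbol Q v := by
    rw [symbol_eq_sum, hR, Polynomial.finsetSum_coeff]
    refine Finset.sum_congr rfl fun k hks => ?_
    rw [Polynomial.coeff_C_mul, ← hk k hks, (coeff_prod_linear_pow _ _ _ _).2]
  have hdeg' : R.natDegree = m :=
    Polynomial.natDegree_eq_of_le_of_coeff_ne_zero hdeg (by rwa [hcoeff])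
  refine ⟨R, hdeg', by rw [Polynomial.leadingCoeff, hdeg', hcoeff], fun s => ?_⟩
  rw [symbol_eq_sum, hR, Polynomial.eval_finsetSum]
  refine Finset.sum_congr rfl fun k _ => ?_
  rw [Polynomial.eval_mul, Polynomial.eval_C, Polynomial.eval_prod]
  congr 1
  refine Finset.prod_congr rfl fun i _ => ?_
  simp only [Polynomial.eval_pow, Polynomial.eval_add, Polynomial.eval_mul, Polynomial.eval_C,
    Polynomial.eval_X, PiLp.add_apply, PiLp.smul_apply, smul_eq_mul, Complex.ofReal_add,
    Complex.ofReal_mul]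
  ring

/-- A uniform bound for the integral of `|s - r|^{-1/2}` over the unit interval. -/
theorem exists_lintegral_sub_rpow_le : ∃ C : ℝ≥0∞, C < ⊤ ∧ ∀ r : ℂ,
    ∫⁻ s : ℝ in Set.Icc 0 1, ‖(s : ℂ) - r‖ₑ ^ (-(1 / 2) : ℝ) ≤ C := by
  have hI : IntegrableOn (fun s : ℝ => ‖s‖ ^ (-(1 / 2) : ℝ)) (Metric.ball 0 2) volume :=
    integrableOn_ball_of_norm_le_rpow (C := 1) (α := 1 / 2) (by simp) (by norm_num)
      (.of_forall fun s => by simp [abs_of_nonneg (Real.rpow_nonneg (abs_nonneg s) _)])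
      (measurable_norm.pow_const _).aestronglyMeasurable
  have hfin : ∫⁻ s in Metric.ball (0 : ℝ) 2, ‖s‖ₑ ^ (-(1 / 2) : ℝ) < ⊤ := by
    refine lt_of_le_of_lt (lintegral_mono_ae ?_) hI.2
    -- At 0 the two conventions differ: the real power is 0, the extended one is `⊤`.
    have h0 : ∀ᵐ s : ℝ ∂volume.restrict (Metric.ball 0 2), s ≠ 0 :=
      ae_restrict_of_ae (Measure.ae_ne volume 0)
    filter_upwards [h0] with s hs
    rw [← ofReal_norm, ← ofReal_norm, Real.norm_of_nonneg (Real.rpow_nonneg (norm_nonneg s) _),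
      ENNReal.ofReal_rpow_of_pos (norm_pos_iff.2 hs)]
  -- Replacing `r` by its real part only increases the integrand. Points at distance at least 2
  -- contribute at most 1 in total, the others at most a translate of the fixed integral.
  refine ⟨1 + ∫⁻ s in Metric.ball (0 : ℝ) 2, ‖s‖ₑ ^ (-(1 / 2) : ℝ), by finiteness, fun r => ?_⟩
  calc ∫⁻ s : ℝ in Set.Icc 0 1, ‖(s : ℂ) - r‖ₑ ^ (-(1 / 2) : ℝ)
      ≤ ∫⁻ s : ℝ in Set.Icc 0 1, (1 + (Metric.ball (0 : ℝ) 2).indicator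
          (fun u => ‖u‖ₑ ^ (-(1 / 2) : ℝ)) (s - r.re)) := by
        refine lintegral_mono fun s => ?_
        have hre : ‖s - r.re‖ₑ ≤ ‖(s : ℂ) - r‖ₑ := by
          rw [← ofReal_norm, ← ofReal_norm]
          refine ENNReal.ofReal_le_ofReal ?_
          simpa using! Complex.abs_re_le_norm ((s : ℂ) - r)
        have h1 : ‖(s : ℂ) - r‖ₑ ^ (-(1 / 2) : ℝ) ≤ ‖s - r.re‖ₑ ^ (-(1 / 2) : ℝ) := by
          rw [ENNReal.rpow_neg, ENNReal.rpow_neg]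
          gcongr
        by_cases hs : s - r.re ∈ Metric.ball (0 : ℝ) 2
        · rw [Set.indicator_of_mem hs]
          exact h1.trans le_add_self
        · rw [Set.indicator_of_notMem hs, add_zero]
          refine h1.trans (ENNReal.rpow_le_one_of_one_le_of_neg ?_ (by norm_num))
          rw [← ofReal_norm, ENNReal.one_le_ofReal]
          rw [mem_ball_zero_iff, not_lt] at hs
          linarith
    _ ≤ 1 + ∫⁻ s : ℝ, (Metric.ball (0 : ℝ) 2).indicator
          (fun u => ‖u‖ₑ ^ (-(1 / 2) : ℝ)) (s - r.re) := by
        rw [lintegral_add_left measurable_const]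
        gcongr
        · simp
        · exact Measure.restrict_le_self
    _ = 1 + ∫⁻ s in Metric.ball (0 : ℝ) 2, ‖s‖ₑ ^ (-(1 / 2) : ℝ) := by
        rw [lintegral_sub_right_eq_self (fun s => (Metric.ball (0 : ℝ) 2).indicator
          (fun u => ‖u‖ₑ ^ (-(1 / 2) : ℝ)) s), lintegral_indicator Metric.isOpen_ball.measurableSet]

/-- A substitute for Hölder: each factor is at most `M^{1/(m+1)}`, where `M ≥ 1` is the right-hand
side, and at most `m` factors multiply to no more than `M`. A sum over roots can be integrated term
by term. -/
theorem enorm_prod_sub_rpow_le (S : Multiset ℂ) {m : ℕ} (hS : S.card ≤ m) (z : ℂ) :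
    ‖(S.map fun r => z - r).prod‖ₑ ^ (-(1 / (2 * (m + 1))) : ℝ) ≤
      1 + (S.map fun r => ‖z - r‖ₑ ^ (-(1 / 2) : ℝ)).sum := by
  set M : ℝ≥0∞ := 1 + (S.map fun r => ‖z - r‖ₑ ^ (-(1 / 2) : ℝ)).sum with hM
  have hm : (0 : ℝ) < m + 1 := by positivity
  have h1 (r) (hr : r ∈ S) : ‖z - r‖ₑ ^ (-(1 / (2 * (m + 1))) : ℝ) ≤ M ^ (1 / (m + 1) : ℝ) := by
    have : ‖z - r‖ₑ ^ (-(1 / 2) : ℝ) ≤ M :=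
      (Multiset.single_le_sum (fun _ _ => zero_le) _ (Multiset.mem_map_of_mem
        (fun r => ‖z - r‖ₑ ^ (-(1 / 2) : ℝ)) hr)).trans le_add_self
    calc ‖z - r‖ₑ ^ (-(1 / (2 * (m + 1))) : ℝ) = (‖z - r‖ₑ ^ (-(1 / 2) : ℝ)) ^ (1 / (m + 1) : ℝ) := by
          rw [← ENNReal.rpow_mul]
          congr 1
          field_simp
      _ ≤ _ := by gcongr
  have h2 (T : Multiset ℂ) (hT : ∀ r ∈ T, ‖z - r‖ₑ ^ (-(1 / (2 * (m + 1))) : ℝ) ≤ M ^ (1 / (m + 1) : ℝ)) :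
      ‖(T.map fun r => z - r).prod‖ₑ ^ (-(1 / (2 * (m + 1))) : ℝ) ≤
        (M ^ (1 / (m + 1) : ℝ)) ^ T.card := by
    induction T using Multiset.induction_on with
    | empty => simp
    | cons a T ih =>
      rw [Multiset.map_cons, Multiset.prod_cons, enorm_mul, Multiset.card_cons, pow_succ',
        ENNReal.mul_rpow_of_ne_top (by simp) (by simp)]
      exact mul_le_mul' (hT a (by simp)) (ih fun r hr => hT r (by simp [hr]))
  refine (h2 S h1).trans ?_
  have hM1 : 1 ≤ M := le_self_add
  rw [← ENNReal.rpow_natCast, ← ENNReal.rpow_mul]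
  refine (ENNReal.rpow_le_rpow_of_exponent_le hM1 ?_).trans_eq (ENNReal.rpow_one M)
  have : (S.card : ℝ) ≤ m := by exact_mod_cast hS
  rw [one_div, inv_mul_le_iff₀ hm]
  linarith

/-- Negative powers of a polynomial of degree at most `m` are integrable over the unit interval,
with a bound depending only on `m` and the leading coefficient. -/
theorem exists_lintegral_polynomial_rpow_le (m : ℕ) : ∃ C : ℝ≥0∞, C < ⊤ ∧ ∀ R : Polynomial ℂ,
    R.natDegree ≤ m → ∫⁻ s : ℝ in Set.Icc 0 1, ‖R.eval (s : ℂ)‖ₑ ^ (-(1 / (2 * (m + 1))) : ℝ) ≤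
      ‖R.leadingCoeff‖ₑ ^ (-(1 / (2 * (m + 1))) : ℝ) * C := by
  obtain ⟨C, hC, hCr⟩ := exists_lintegral_sub_rpow_le
  -- The case `R = 0` is included: both sides are then `⊤`.
  refine ⟨1 + m * C, by finiteness, fun R hR => ?_⟩
  have hsum (S : Multiset ℂ) : ∫⁻ s : ℝ in Set.Icc 0 1,
      (S.map fun r => ‖(s : ℂ) - r‖ₑ ^ (-(1 / 2) : ℝ)).sum ≤ S.card * C := by
    induction S using Multiset.induction_on with
    | empty => simp
    | cons a S ih =>
      simp only [Multiset.map_cons, Multiset.sum_cons, Multiset.card_cons]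
      rw [lintegral_add_left (by fun_prop)]
      refine (add_le_add (hCr a) ih).trans_eq ?_
      push_cast
      ring
  have hmeas (S : Multiset ℂ) :
      Measurable fun s : ℝ => (S.map fun r => ‖(s : ℂ) - r‖ₑ ^ (-(1 / 2) : ℝ)).sum := by
    induction S using Multiset.induction_on with
    | empty => simp
    | cons a S ih =>
      simp only [Multiset.map_cons, Multiset.sum_cons]
      exact Measurable.add (by fun_prop) ih
  have hroots : R.roots.card ≤ m := (Polynomial.card_roots' R).trans hR
  calc ∫⁻ s : ℝ in Set.Icc 0 1, ‖R.eval (s : ℂ)‖ₑ ^ (-(1 / (2 * (m + 1))) : ℝ)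
      ≤ ∫⁻ s : ℝ in Set.Icc 0 1, ‖R.leadingCoeff‖ₑ ^ (-(1 / (2 * (m + 1))) : ℝ) *
          (1 + (R.roots.map fun r => ‖(s : ℂ) - r‖ₑ ^ (-(1 / 2) : ℝ)).sum) := by
        refine lintegral_mono fun s => ?_
        simp only
        rw [(IsAlgClosed.splits R).eval_eq_prod_roots, enorm_mul,
          ENNReal.mul_rpow_of_ne_top (by simp) (by simp)]
        gcongr
        exact enorm_prod_sub_rpow_le _ hroots _
    _ ≤ ‖R.leadingCoeff‖ₑ ^ (-(1 / (2 * (m + 1))) : ℝ) * ∫⁻ s : ℝ in Set.Icc 0 1,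
          (1 + (R.roots.map fun r => ‖(s : ℂ) - r‖ₑ ^ (-(1 / 2) : ℝ)).sum) := by
        exact (lintegral_const_mul _ ((hmeas R.roots).const_add 1)).le
    _ ≤ ‖R.leadingCoeff‖ₑ ^ (-(1 / (2 * (m + 1))) : ℝ) * (1 + m * C) := by
        gcongr
        rw [lintegral_add_left measurable_const]
        gcongr
        · simp
        · exact (hsum _).trans (by gcongr)

theorem contDiff_symbol (P : MvPolynomial (Fin n) ℂ) : ContDiff ℝ ∞ (symbol P) :=
  (hasTemperateGrowth_symbol P).1

theorem continuous_symbol (P : MvPolynomial (Fin n) ℂ) : Continuous (symbol P) :=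
  (contDiff_symbol P).continuous

/-- A polynomial vanishing on a product of infinite sets, here copies of the imaginary axis, is
zero. -/
theorem exists_symbol_ne_zero {Q : MvPolynomial (Fin n) ℂ} (hQ : Q ≠ 0) :
    ∃ v : Space n, symbol Q v ≠ 0 := by
  by_contra! h
  refine hQ (MvPolynomial.funext_set
    (fun _ => Set.range fun s : ℝ => 2 * (Real.pi : ℂ) * Complex.I * (s : ℂ)) (fun _ => ?_) ?_)
  · refine Set.infinite_range_of_injective fun s t hst => ?_
    have : (2 * (Real.pi : ℂ) * Complex.I) ≠ 0 := by simp
    exact_mod_cast mul_left_cancel₀ this hst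
  · intro x hx
    choose y hy using fun i => hx i (Set.mem_univ i)
    have := h (WithLp.toLp 2 y)
    simp only [symbol, hy] at this
    simpa using this

/-- A small negative power of a nonzero homogeneous symbol is locally integrable. -/
theorem lintegral_ball_symbol_rpow_lt_top {Q : MvPolynomial (Fin n) ℂ} {m : ℕ}
    (hQ : Q.IsHomogeneous m) (hQ0 : Q ≠ 0) (r : ℝ) :
    ∫⁻ ξ in Metric.ball (0 : Space n) r, ‖symbol Q ξ‖ₑ ^ (-(1 / (2 * (m + 1))) : ℝ) < ⊤ := by
  obtain ⟨v, hv⟩ := exists_symbol_ne_zero hQ0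
  obtain ⟨C, hC, hCR⟩ := exists_lintegral_polynomial_rpow_le m
  set δ : ℝ := -(1 / (2 * (m + 1)))
  have hm : Measurable fun ξ => ‖symbol Q ξ‖ₑ ^ δ := by
    have := (continuous_symbol Q).measurable
    fun_prop
  have hm2 : Measurable fun z : ℝ × Space n => ‖symbol Q (z.2 + z.1 • v)‖ₑ ^ δ :=
    hm.comp (by fun_prop)
  -- Averaging over the translations `s • v`, at the cost of a larger ball, reduces the integral to
  -- line integrals in the direction `v`, whose leading coefficient `symbol Q v` is nonzero and
  -- independent of the base point.
  have htrans (s : ℝ) (hs : s ∈ Set.Icc (0 : ℝ) 1) :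
      ∫⁻ ξ in Metric.ball (0 : Space n) r, ‖symbol Q ξ‖ₑ ^ δ ≤
        ∫⁻ ξ in Metric.ball (0 : Space n) (r + ‖v‖), ‖symbol Q (ξ + s • v)‖ₑ ^ δ := by
    rw [← lintegral_indicator Metric.isOpen_ball.measurableSet,
      ← lintegral_indicator Metric.isOpen_ball.measurableSet,
      ← lintegral_add_right_eq_self _ (s • v)]
    refine lintegral_mono fun ξ => ?_
    by_cases h : ξ + s • v ∈ Metric.ball (0 : Space n) r
    · rw [Set.indicator_of_mem h, Set.indicator_of_mem]
      rw [mem_ball_zero_iff] at h ⊢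
      have h1 : ‖ξ‖ ≤ ‖ξ + s • v‖ + ‖s • v‖ := by simpa using norm_sub_le (ξ + s • v) (s • v)
      have h2 : ‖s • v‖ ≤ ‖v‖ := by
        rw [norm_smul, Real.norm_of_nonneg hs.1]
        exact mul_le_of_le_one_left (norm_nonneg _) hs.2
      linarith
    · rw [Set.indicator_of_notMem h]
      exact zero_le
  calc ∫⁻ ξ in Metric.ball (0 : Space n) r, ‖symbol Q ξ‖ₑ ^ δ
      = ∫⁻ _s : ℝ in Set.Icc 0 1, ∫⁻ ξ in Metric.ball (0 : Space n) r, ‖symbol Q ξ‖ₑ ^ δ := by simp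
    _ ≤ ∫⁻ s : ℝ in Set.Icc 0 1, ∫⁻ ξ in Metric.ball (0 : Space n) (r + ‖v‖),
          ‖symbol Q (ξ + s • v)‖ₑ ^ δ := setLIntegral_mono' measurableSet_Icc htrans
    _ = ∫⁻ ξ in Metric.ball (0 : Space n) (r + ‖v‖), ∫⁻ s : ℝ in Set.Icc 0 1,
          ‖symbol Q (ξ + s • v)‖ₑ ^ δ := lintegral_lintegral_swap hm2.aemeasurable
    _ ≤ ∫⁻ _ξ in Metric.ball (0 : Space n) (r + ‖v‖), ‖symbol Q v‖ₑ ^ δ * C := by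
        refine lintegral_mono fun ξ => ?_
        obtain ⟨R, hR1, hR2, hR3⟩ := exists_polynomial_symbol_line hQ ξ v hv
        simp only [← hR3, ← hR2]
        exact hCR R hR1.le
    _ < ⊤ := by
        rw [setLIntegral_const]
        refine ENNReal.mul_lt_top (ENNReal.mul_lt_top ?_ hC) measure_ball_lt_top
        exact lt_top_iff_ne_top.2 (ENNReal.rpow_ne_top_of_ne_zero (by simpa) (by simp))

end Sublevel

/-! ### Critical integrability of `1/p` at the origin. -/

section LowFrequency

variable {n α : ℕ} {P : MvPolynomial (Fin n) ℂ}

theorem symbol_smul_of_isHomogeneous {Q : MvPolynomial (Fin n) ℂ} {m : ℕ} (hQ : Q.IsHomogeneous m)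
    (t : ℝ) (ξ : Space n) : symbol Q (t • ξ) = (t : ℂ) ^ m * symbol Q ξ := by
  rw [symbol_eq_sum, symbol_eq_sum, Finset.mul_sum]
  refine Finset.sum_congr rfl fun k hk => ?_
  have hkm : ∑ i, k i = m := by
    rw [hQ.degree_eq_sum_deg_support hk]
    exact (Finset.sum_subset (Finset.subset_univ _) (by simp)).symm
  rw [← hkm, ← Finset.prod_pow_eq_pow_sum, mul_left_comm, ← Finset.prod_mul_distrib]
  congr 1
  refine Finset.prod_congr rfl fun i _ => ?_
  rw [← mul_pow]
  congr 1
  simp only [PiLp.smul_apply, smul_eq_mul, Complex.ofReal_mul]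
  ring

theorem symbol_eq_sum_homogeneousComponent (hP : P.totalDegree = α) (ξ : Space n) :
    symbol P ξ = ∑ j ∈ Finset.range (α + 1), symbol (P.homogeneousComponent j) ξ := by
  have : ∑ j ∈ Finset.range (α + 1), P.homogeneousComponent j = P := by
    rw [← hP]
    exact MvPolynomial.sum_homogeneousComponent P
  conv_lhs => rw [← this]
  simp only [symbol, map_sum]

theorem symbol_smul_eq_sum (hP : P.totalDegree = α) (t : ℝ) (ξ : Space n) : symbol P (t • ξ) =
    ∑ j ∈ Finset.range (α + 1), (t : ℂ) ^ j * symbol (P.homogeneousComponent j) ξ := by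
  rw [symbol_eq_sum_homogeneousComponent hP]
  exact Finset.sum_congr rfl fun j _ =>
    symbol_smul_of_isHomogeneous (MvPolynomial.homogeneousComponent_isHomogeneous j P) t ξ

/-- A non-homogeneous operator has a nonzero homogeneous part of least degree `m < α`. -/
theorem exists_least_homogeneousComponent (hP : P.totalDegree = α) (hnh : ¬ P.IsHomogeneous α) :
    ∃ m < α, P.homogeneousComponent m ≠ 0 ∧ ∀ j < m, P.homogeneousComponent j = 0 := by
  classical
  have hex : ∃ j, P.homogeneousComponent j ≠ 0 ∧ j < α := by
    by_contra! h
    refine hnh ?_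
    rw [← MvPolynomial.sum_homogeneousComponent P, hP]
    refine MvPolynomial.IsHomogeneous.sum _ _ _ fun j hj => ?_
    rcases (Finset.mem_range_succ_iff.1 hj).eq_or_lt with rfl | hlt
    · exact MvPolynomial.homogeneousComponent_isHomogeneous j P
    · have : P.homogeneousComponent j = 0 := by
        by_contra h0
        exact absurd (h j h0) (not_le.2 hlt)
      rw [this]
      exact MvPolynomial.isHomogeneous_zero _ _ _
  refine ⟨Nat.find hex, (Nat.find_spec hex).2, (Nat.find_spec hex).1, fun j hj => ?_⟩
  by_contra h0
  exact Nat.find_min hex hj ⟨h0, hj.trans (Nat.find_spec hex).2⟩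

/-- On dyadic annuli the symbol improves on the bound `t ^ α` by a factor `t⁻¹`, away from the
zeros of its lowest-order part. -/
theorem exists_mul_norm_component_le_norm_symbol (hP : P.totalDegree = α) {m : ℕ} (hm : m < α)
    (hlow : ∀ j < m, P.homogeneousComponent j = 0) {c₁ : ℝ} (hc₁ : 0 < c₁)
    (hlower : ∀ ξ : Space n, c₁ * ‖ξ‖ ^ α ≤ ‖symbol P ξ‖) :
    ∃ c > 0, ∀ t : ℝ, 0 < t → t ≤ 1 → ∀ η : Space n, 1 / 2 ≤ ‖η‖ → ‖η‖ ≤ 1 →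
      c * t ^ α ≤ ‖symbol P (t • η)‖ ∧
      c * t ^ (α - 1) * ‖symbol (P.homogeneousComponent m) η‖ ≤ ‖symbol P (t • η)‖ := by
  have hbdd (j : ℕ) : ∃ B, ∀ η ∈ Metric.closedBall (0 : Space n) 1,
      ‖symbol (P.homogeneousComponent j) η‖ ≤ B :=
    (isCompact_closedBall _ _).exists_bound_of_continuousOn (continuous_symbol _).continuousOn
  choose B hB using hbdd
  have hB0 (j : ℕ) : 0 ≤ B j := (norm_nonneg _).trans (hB j 0 (by simp))
  set S : ℝ := ∑ j ∈ Finset.range (α + 1), B j with hS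
  have hS0 : 0 ≤ S := Finset.sum_nonneg fun j _ => hB0 j
  -- The factor `(1 / 2) ^ α` comes from `‖η‖ ≥ 1 / 2`.
  set c : ℝ := c₁ * (1 / 2) ^ α with hc
  have hc0 : 0 < c := by positivity
  set D : ℝ := 1 + S / c with hD
  have hD0 : 0 < D := by positivity
  refine ⟨min c D⁻¹, lt_min hc0 (by positivity), fun t ht ht1 η hη hη1 => ?_⟩
  have h1 : c * t ^ α ≤ ‖symbol P (t • η)‖ := by
    refine le_trans ?_ (hlower _)
    rw [norm_smul, Real.norm_of_nonneg ht.le, mul_pow, hc]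
    calc c₁ * (1 / 2) ^ α * t ^ α = c₁ * (t ^ α * (1 / 2) ^ α) := by ring
      _ ≤ _ := by gcongr
  refine ⟨le_trans (by gcongr; exact min_le_left _ _) h1, ?_⟩
  have hmem : m ∈ Finset.range (α + 1) := Finset.mem_range.2 (by omega)
  have hsum := symbol_smul_eq_sum hP t η
  rw [← Finset.add_sum_erase _ _ hmem] at hsum
  have hrest : ‖∑ j ∈ (Finset.range (α + 1)).erase m,
      (t : ℂ) ^ j * symbol (P.homogeneousComponent j) η‖ ≤ t ^ (m + 1) * S := by
    rw [hS, Finset.mul_sum]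
    refine (norm_sum_le _ _).trans ((Finset.sum_le_sum fun j hj => ?_).trans
      (Finset.sum_le_sum_of_subset_of_nonneg (Finset.erase_subset m _) fun j _ _ =>
        mul_nonneg (by positivity) (hB0 j)))
    rcases lt_trichotomy j m with hjm | rfl | hjm
    · rw [hlow j hjm]
      simp only [symbol, map_zero, mul_zero, norm_zero]
      exact mul_nonneg (by positivity) (hB0 j)
    · simp at hj
    · rw [norm_mul, norm_pow, Complex.norm_real, Real.norm_of_nonneg ht.le]
      exact mul_le_mul (pow_le_pow_of_le_one ht.le ht1 hjm) (hB j η (by simpa using hη1))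
        (norm_nonneg _) (by positivity)
  -- Below degree `m` nothing remains, and all higher parts carry at least `t^{m+1}`. Multiplying by
  -- `t^{α-m-1}` makes the error `t^α S`, which the first bound absorbs into `|p(tη)|`.
  have h2 : t ^ m * ‖symbol (P.homogeneousComponent m) η‖ ≤
      ‖symbol P (t • η)‖ + t ^ (m + 1) * S := by
    have : (t : ℂ) ^ m * symbol (P.homogeneousComponent m) η = symbol P (t • η) -
        ∑ j ∈ (Finset.range (α + 1)).erase m,
          (t : ℂ) ^ j * symbol (P.homogeneousComponent j) η := by
      rw [hsum]; ring
    calc t ^ m * ‖symbol (P.homogeneousComponent m) η‖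
        = ‖(t : ℂ) ^ m * symbol (P.homogeneousComponent m) η‖ := by
          rw [norm_mul, norm_pow, Complex.norm_real, Real.norm_of_nonneg ht.le]
      _ ≤ _ := by
          rw [this]
          exact (norm_sub_le _ _).trans (by gcongr)
  obtain ⟨e, rfl⟩ : ∃ e, α = m + 1 + e := ⟨α - (m + 1), by omega⟩
  have he : m + 1 + e - 1 = m + e := by omega
  rw [he]
  have h3 : t ^ e ≤ 1 := pow_le_one₀ ht.le ht1
  have h4 : t ^ (m + 1 + e) * S ≤ S / c * ‖symbol P (t • η)‖ := by
    rw [div_mul_eq_mul_div, le_div_iff₀ hc0]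
    nlinarith [mul_le_mul_of_nonneg_left h1 hS0]
  have h5 : t ^ (m + e) * ‖symbol (P.homogeneousComponent m) η‖ ≤ D * ‖symbol P (t • η)‖ := by
    calc t ^ (m + e) * ‖symbol (P.homogeneousComponent m) η‖
        = t ^ e * (t ^ m * ‖symbol (P.homogeneousComponent m) η‖) := by ring
      _ ≤ t ^ e * (‖symbol P (t • η)‖ + t ^ (m + 1) * S) := by gcongr
      _ = t ^ e * ‖symbol P (t • η)‖ + t ^ (m + 1 + e) * S := by ring
      _ ≤ 1 * ‖symbol P (t • η)‖ + S / c * ‖symbol P (t • η)‖ := by gcongr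
      _ = D * ‖symbol P (t • η)‖ := by rw [hD]; ring
  calc min c D⁻¹ * t ^ (m + e) * ‖symbol (P.homogeneousComponent m) η‖
      ≤ D⁻¹ * (t ^ (m + e) * ‖symbol (P.homogeneousComponent m) η‖) := by
        rw [mul_assoc]
        gcongr
        exact min_le_right _ _
    _ ≤ D⁻¹ * (D * ‖symbol P (t • η)‖) := by gcongr
    _ = ‖symbol P (t • η)‖ := by field_simp

theorem lintegral_comp_smul_space (f : Space n → ℝ≥0∞) {t : ℝ} (ht : 0 < t) :
    ∫⁻ ξ, f ξ = ENNReal.ofReal (t ^ n) * ∫⁻ η, f (t • η) := by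
  have hmap := Measure.map_addHaar_smul (volume : Measure (Space n)) ht.ne'
  have he : MeasurableEmbedding fun η : Space n => t • η :=
    (Homeomorph.smulOfNeZero t ht.ne').measurableEmbedding
  have h := he.lintegral_map (μ := volume) f
  rw [hmap, lintegral_smul_measure] at h
  rw [← h, smul_eq_mul, ← mul_assoc, ← ENNReal.ofReal_mul (by positivity), finrank_euclideanSpace,
    Fintype.card_fin, abs_of_pos (by positivity), mul_inv_cancel₀ (by positivity)]
  simp

/-- The critical integrability of `1 / p` at the origin: non-homogeneity improves the weak-type
bound coming from `|p(ξ)| ≥ c₁ |ξ| ^ α`. -/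
theorem lintegral_ball_symbol_rpow_neg_lt_top (hα0 : 0 < α) (hαn : α < n) (hP : P.totalDegree = α)
    (hnh : ¬ P.IsHomogeneous α) {c₁ : ℝ} (hc₁ : 0 < c₁)
    (hlower : ∀ ξ : Space n, c₁ * ‖ξ‖ ^ α ≤ ‖symbol P ξ‖) :
    ∫⁻ ξ in Metric.ball (0 : Space n) 1, ‖symbol P ξ‖ₑ ^ (-(n / α : ℝ)) < ⊤ := by
  obtain ⟨m, hm, hm0, hlow⟩ := exists_least_homogeneousComponent hP hnh
  obtain ⟨c, hc, hct⟩ := exists_mul_norm_component_le_norm_symbol hP hm hlow hc₁ hlower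
  set Q := P.homogeneousComponent m
  set δ : ℝ := 1 / (2 * (m + 1)) with hδ
  have hδ0 : 0 < δ := by positivity
  have hδ1 : δ ≤ 1 := by
    rw [hδ, div_le_one (by positivity)]
    have : (0 : ℝ) ≤ m := by positivity
    linarith
  have hαR : (0 : ℝ) < α := by exact_mod_cast hα0
  set s : ℝ := n / α with hs
  have hs1 : 1 ≤ s := by
    rw [hs, one_le_div hαR]
    exact_mod_cast hαn.le
  have hsα : α * s = n := by rw [hs]; field_simp
  set I : ℝ≥0∞ := ∫⁻ η in Metric.ball (0 : Space n) 2, ‖symbol Q η‖ₑ ^ (-δ)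
  have hI : I < ⊤ := lintegral_ball_symbol_rpow_lt_top
    (MvPolynomial.homogeneousComponent_isHomogeneous m P) hm0 2
  have hpoint (t : ℝ) (ht : 0 < t) (ht1 : t ≤ 1) (η : Space n) (hη : 1 / 2 ≤ ‖η‖) (hη1 : ‖η‖ ≤ 1) :
      ‖symbol P (t • η)‖ₑ ^ (-s) ≤
        ENNReal.ofReal (c ^ (-s) * t ^ (δ - n)) * ‖symbol Q η‖ₑ ^ (-δ) := by
    obtain ⟨h1, h2⟩ := hct t ht ht1 η hη hη1
    have hne : ‖symbol P (t • η)‖ₑ ≠ 0 := by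
      rw [enorm_ne_zero, ← norm_pos_iff]
      exact lt_of_lt_of_le (by positivity) h1
    have h1' : ENNReal.ofReal (c * t ^ α) ≤ ‖symbol P (t • η)‖ₑ := by
      rw [← ofReal_norm]
      exact ENNReal.ofReal_le_ofReal h1
    have h2' : ENNReal.ofReal (c * t ^ (α - 1)) * ‖symbol Q η‖ₑ ≤ ‖symbol P (t • η)‖ₑ := by
      rw [← ofReal_norm, ← ofReal_norm, ← ENNReal.ofReal_mul (by positivity)]
      exact ENNReal.ofReal_le_ofReal h2
    have hneg {a b : ℝ≥0∞} (hab : a ≤ b) {r : ℝ} (hr : 0 ≤ r) : b ^ (-r) ≤ a ^ (-r) := by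
      rw [ENNReal.rpow_neg, ENNReal.rpow_neg]
      gcongr
    -- Interpolation: the power `s - δ` uses the bound `t^α`, the power `δ` the bound `t^{α-1}|Q|`.
    -- With `αs = n` the exponent of `t` is `-n + δ`.
    calc ‖symbol P (t • η)‖ₑ ^ (-s)
        = ‖symbol P (t • η)‖ₑ ^ (-(s - δ)) * ‖symbol P (t • η)‖ₑ ^ (-δ) := by
          rw [← ENNReal.rpow_add _ _ hne (by simp)]
          ring_nf
      _ ≤ ENNReal.ofReal (c * t ^ α) ^ (-(s - δ)) *
            (ENNReal.ofReal (c * t ^ (α - 1)) * ‖symbol Q η‖ₑ) ^ (-δ) :=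
          mul_le_mul' (hneg h1' (by linarith)) (hneg h2' hδ0.le)
      _ = ENNReal.ofReal (c ^ (-s) * t ^ (δ - n)) * ‖symbol Q η‖ₑ ^ (-δ) := by
          rw [ENNReal.mul_rpow_of_ne_top (by simp) (by simp), ← mul_assoc,
            ENNReal.ofReal_rpow_of_pos (by positivity), ENNReal.ofReal_rpow_of_pos (by positivity),
            ← ENNReal.ofReal_mul (by positivity)]
          congr 2
          rw [Real.mul_rpow hc.le (by positivity), Real.mul_rpow hc.le (by positivity),
            ← Real.rpow_natCast, ← Real.rpow_natCast, ← Real.rpow_mul ht.le, ← Real.rpow_mul ht.le,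
            mul_mul_mul_comm, ← Real.rpow_add hc, ← Real.rpow_add ht]
          congr 2
          · ring
          · rw [Nat.cast_sub hα0, ← hsα]
            push_cast
            ring
  set A : Set (Space n) := {η | 1 / 2 ≤ ‖η‖ ∧ ‖η‖ ≤ 1} with hA
  have hAm : MeasurableSet A :=
    (measurableSet_le measurable_const measurable_norm).inter
      (measurableSet_le measurable_norm measurable_const)
  let T : ℕ → ℝ := fun k => (1 / 2) ^ k
  have hT0 (k : ℕ) : 0 < T k := by positivity
  have hT1 (k : ℕ) : T k ≤ 1 := pow_le_one₀ (by norm_num) (by norm_num)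
  let Ak : ℕ → Set (Space n) := fun k => {ξ | (T k)⁻¹ • ξ ∈ A}
  have hAkm (k : ℕ) : MeasurableSet (Ak k) := (measurable_const_smul (T k)⁻¹) hAm
  -- The Jacobian `t^n` cancels `t^{-n}`, leaving the geometric factor `2^{-kδ}`.
  have hdyadic (k : ℕ) : ∫⁻ ξ in Ak k, ‖symbol P ξ‖ₑ ^ (-s) ≤
      ENNReal.ofReal ((1 / 2) ^ δ) ^ k * (ENNReal.ofReal (c ^ (-s)) * I) := by
    rw [← lintegral_indicator (hAkm k), lintegral_comp_smul_space _ (hT0 k)]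
    calc ENNReal.ofReal (T k ^ n) *
          ∫⁻ η, (Ak k).indicator (fun ξ => ‖symbol P ξ‖ₑ ^ (-s)) (T k • η)
        ≤ ENNReal.ofReal (T k ^ n) * ∫⁻ η, (Metric.ball (0 : Space n) 2).indicator
            (fun η => ENNReal.ofReal (c ^ (-s) * T k ^ (δ - n)) * ‖symbol Q η‖ₑ ^ (-δ)) η := by
          gcongr with η
          by_cases hη : η ∈ A
          · rw [Set.indicator_of_mem, Set.indicator_of_mem]
            · exact hpoint _ (hT0 k) (hT1 k) η hη.1 hη.2
            · rw [mem_ball_zero_iff]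
              linarith [hη.2]
            · simpa [Ak, smul_smul, (hT0 k).ne'] using hη
          · rw [Set.indicator_of_notMem]
            · exact zero_le
            · simpa [Ak, smul_smul, (hT0 k).ne'] using hη
      _ = ENNReal.ofReal (T k ^ n) * (ENNReal.ofReal (c ^ (-s) * T k ^ (δ - n)) * I) := by
          rw [lintegral_indicator Metric.isOpen_ball.measurableSet, lintegral_const_mul' _ _ (by simp)]
      _ = _ := by
          rw [← mul_assoc, ← mul_assoc, ← ENNReal.ofReal_mul (by positivity),
            ← ENNReal.ofReal_pow (by positivity), ← ENNReal.ofReal_mul (by positivity)]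
          congr 2
          have h6 : ((1 / 2 : ℝ) ^ δ) ^ k = T k ^ δ := by
            rw [← Real.rpow_natCast, ← Real.rpow_mul (by norm_num), mul_comm,
              Real.rpow_mul (by norm_num), Real.rpow_natCast]
          rw [h6, Real.rpow_sub (hT0 k), Real.rpow_natCast]
          have : T k ^ n ≠ 0 := (pow_pos (hT0 k) n).ne'
          field_simp
  have hcover : Metric.ball (0 : Space n) 1 ≤ᵐ[volume] ⋃ k, Ak k := by
    have : Nonempty (Fin n) := ⟨⟨0, by omega⟩⟩
    filter_upwards [Measure.ae_ne volume (0 : Space n)] with ξ hξ hmem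
    have hξ0 : 0 < ‖ξ‖ := norm_pos_iff.2 hξ
    have hξ1 : ‖ξ‖ < 1 := mem_ball_zero_iff.1 hmem
    obtain ⟨k, hk1, hk2⟩ := exists_nat_pow_near_of_lt_one hξ0 hξ1.le
      (by norm_num : (0 : ℝ) < 1 / 2) (by norm_num)
    refine Set.mem_iUnion.2 ⟨k, ?_⟩
    have hnorm : ‖(T k)⁻¹ • ξ‖ = ‖ξ‖ / T k := by
      rw [norm_smul, norm_inv, Real.norm_of_nonneg (hT0 k).le, inv_mul_eq_div]
    refine ⟨?_, ?_⟩
    · rw [hnorm, le_div_iff₀ (hT0 k)]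
      simp only [T]
      rw [pow_succ] at hk1
      linarith
    · rw [hnorm, div_le_one (hT0 k)]
      exact hk2
  calc ∫⁻ ξ in Metric.ball (0 : Space n) 1, ‖symbol P ξ‖ₑ ^ (-s)
      ≤ ∫⁻ ξ in ⋃ k, Ak k, ‖symbol P ξ‖ₑ ^ (-s) := lintegral_mono_set' hcover
    _ ≤ ∑' k, ∫⁻ ξ in Ak k, ‖symbol P ξ‖ₑ ^ (-s) := lintegral_iUnion_le _ _
    _ ≤ ∑' k, ENNReal.ofReal ((1 / 2) ^ δ) ^ k * (ENNReal.ofReal (c ^ (-s)) * I) :=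
        ENNReal.tsum_le_tsum hdyadic
    _ < ⊤ := by
        rw [ENNReal.tsum_mul_right, ENNReal.tsum_geometric]
        refine ENNReal.mul_lt_top ?_ (ENNReal.mul_lt_top ENNReal.ofReal_lt_top hI)
        rw [ENNReal.inv_lt_top, tsub_pos_iff_lt, ENNReal.ofReal_lt_one]
        exact Real.rpow_lt_one (by norm_num) (by norm_num) hδ0

end LowFrequency

/-! ### Uniform Schwartz bounds for smooth families with common compact support. -/

section SchwartzFamily

variable {E : Type*} [NormedAddCommGroup E] [NormedSpace ℝ E] [FiniteDimensional ℝ E]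

/-- Slice derivatives are joint derivatives restricted along the inclusion of `E`, hence bounded on
a compact set of parameters and points; outside the ball they vanish. -/
theorem exists_bound_iteratedFDeriv_slice {G : ℝ × E → ℂ} (hG : ContDiff ℝ ∞ G) {R : ℝ}
    (hsupp : ∀ t x, R ≤ ‖x‖ → G (t, x) = 0) (k l : ℕ) :
    ∃ C, 0 ≤ C ∧ ∀ t ∈ Set.Icc (0 : ℝ) 1, ∀ x,
      ‖x‖ ^ k * ‖iteratedFDeriv ℝ l (fun y => G (t, y)) x‖ ≤ C := by
  have hcont : Continuous fun z : ℝ × E => ‖z.2‖ ^ k *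
      (‖iteratedFDeriv ℝ l G z‖ * ∏ _i : Fin l, ‖ContinuousLinearMap.inr ℝ ℝ E‖) := by
    have := hG.continuous_iteratedFDeriv (m := l) (by exact_mod_cast le_top)
    fun_prop
  obtain ⟨C, hC⟩ := (isCompact_Icc.prod (isCompact_closedBall (0 : E) R)).exists_bound_of_continuousOn
    (s := Set.Icc (0 : ℝ) 1 ×ˢ Metric.closedBall (0 : E) R) hcont.continuousOn
  refine ⟨max C 0, le_max_right _ _, fun t ht x => ?_⟩
  by_cases hx : x ∈ Metric.closedBall (0 : E) R
  · refine le_trans ?_ ((Real.le_norm_self _).trans ((hC (t, x) ⟨ht, hx⟩).trans (le_max_left _ _)))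
    simp only
    gcongr
    have hcomp : (fun y => G (t, y)) = (fun z => G ((t, 0) + z)) ∘ ContinuousLinearMap.inr ℝ ℝ E := by
      ext y
      simp
    have hGt : ContDiff ℝ ∞ fun z : ℝ × E => G ((t, 0) + z) :=
      hG.comp (contDiff_const.add contDiff_id)
    rw [hcomp, ContinuousLinearMap.iteratedFDeriv_comp_right _ hGt x (by exact_mod_cast le_top),
      iteratedFDeriv_comp_add_left]
    refine (ContinuousMultilinearMap.norm_compContinuousLinearMap_le _ _).trans_eq ?_
    simp
  · have hts : tsupport (fun y => G (t, y)) ⊆ Metric.closedBall (0 : E) R := by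
      refine closure_minimal (fun y hy => ?_) Metric.isClosed_closedBall
      by_contra hyR
      rw [mem_closedBall_zero_iff, not_le] at hyR
      exact hy (hsupp t y hyR.le)
    have h0 : iteratedFDeriv ℝ l (fun y => G (t, y)) x = 0 := by
      by_contra hne
      exact hx (hts (support_iteratedFDeriv_subset l hne))
    simp [h0]

/-- A smooth family of functions with support in a fixed ball is bounded in the Schwartz space,
locally uniformly in the parameter. -/
theorem exists_bound_seminorm_slice {G : ℝ × E → ℂ} (hG : ContDiff ℝ ∞ G) {R : ℝ}
    (hsupp : ∀ t x, R ≤ ‖x‖ → G (t, x) = 0) {g : ℝ → 𝓢(E, ℂ)} (hg : ∀ t x, g t x = G (t, x))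
    (q : Seminorm ℂ 𝓢(E, ℂ)) (hq : Continuous q) :
    ∃ C, 0 ≤ C ∧ ∀ t ∈ Set.Icc (0 : ℝ) 1, q (g t) ≤ C := by
  obtain ⟨s, C, -, hC⟩ := Seminorm.bound_of_continuous (schwartz_withSeminorms ℂ E ℂ) q hq
  choose B hB0 hB using exists_bound_iteratedFDeriv_slice hG hsupp
  set S : ℝ := ∑ i ∈ s, B i.1 i.2 with hS
  have hS0 : 0 ≤ S := Finset.sum_nonneg fun i _ => hB0 _ _
  refine ⟨C * S, by positivity, fun t ht => (hC (g t)).trans ?_⟩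
  change (C : ℝ) * (s.sup (schwartzSeminormFamily ℂ E ℂ)) (g t) ≤ C * S
  refine mul_le_mul_of_nonneg_left ?_ C.2
  refine Seminorm.finset_sup_apply_le hS0 fun i hi => ?_
  refine le_trans ?_ (Finset.single_le_sum (f := fun i : ℕ × ℕ => B i.1 i.2)
    (fun i _ => hB0 _ _) hi)
  refine SchwartzMap.seminorm_le_bound ℂ _ _ _ (hB0 _ _) fun x => ?_
  have : (g t : E → ℂ) = fun y => G (t, y) := funext (hg t)
  rw [this]
  exact hB _ _ t ht x

end SchwartzFamily

/-! ### Integrability of series absolutely convergent in `L¹`. -/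

section Series

theorem integrable_tsum_of_summable_integral_norm {X : Type*} [MeasurableSpace X] {μ : Measure X}
    {F : ℕ → X → ℂ} (hF : ∀ j, Integrable (F j) μ) (hs : Summable fun j => ∫ x, ‖F j x‖ ∂μ) :
    Integrable (fun x => ∑' j, F j x) μ := by
  let f : ℕ → Lp ℂ 1 μ := fun j => (memLp_one_iff_integrable.2 (hF j)).toLp (F j)
  have hf : ∑' j, ‖f j‖ₑ ≠ ⊤ := by
    have hn (j : ℕ) : ‖f j‖ = ∫ x, ‖F j x‖ ∂μ := L1.norm_of_fun_eq_integral_norm (hF j)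
    exact tsum_enorm_ne_top_iff_summable_norm.2 (by simpa only [hn] using hs)
  have hcoe : ∀ᵐ x ∂μ, ∀ j, f j x = F j x :=
    ae_all_iff.2 fun j => MemLp.coeFn_toLp (memLp_one_iff_integrable.2 (hF j))
  refine (L1.integrable_coeFn (∑' j, f j)).congr ?_
  filter_upwards [Lp.coeFn_tsum hf, hcoe] with x h1 h2
  rw [h1]
  exact tsum_congr h2

end Series

/-! ### Dyadic construction of the high-frequency kernel. -/

section HighFrequency

variable {n α : ℕ} {P : MvPolynomial (Fin n) ℂ}

theorem fourier_comp_inv_smul (h : Space n → ℂ) {r : ℝ} (hr : 0 < r) (ξ : Space n) :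
    𝓕 (fun x => h (r⁻¹ • x)) ξ = (r : ℂ) ^ n * 𝓕 h (r • ξ) := by
  rw [Real.fourier_eq, Real.fourier_eq]
  have := Measure.integral_comp_inv_smul (volume : Measure (Space n))
    (fun v => Real.fourierChar (-inner ℝ v (r • ξ)) • h v) r
  rw [finrank_euclideanSpace, Fintype.card_fin, abs_of_pos (by positivity)] at this
  rw [← Complex.ofReal_pow, ← Complex.real_smul, ← this]
  refine integral_congr_ae (.of_forall fun v => ?_)
  simp only
  rw [inner_smul_right, inner_smul_left]
  simp [hr.ne']

/-- The symbol rescaled to frequency `t⁻¹`, which extends smoothly to the principal symbol at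
`t = 0`. -/
noncomputable def rescaledSymbol (P : MvPolynomial (Fin n) ℂ) (α : ℕ) (z : ℝ × Space n) : ℂ :=
  ∑ j ∈ Finset.range (α + 1), (z.1 : ℂ) ^ (α - j) * symbol (P.homogeneousComponent j) z.2

theorem contDiff_rescaledSymbol (P : MvPolynomial (Fin n) ℂ) (α : ℕ) :
    ContDiff ℝ ∞ (rescaledSymbol P α) := by
  refine ContDiff.sum fun j _ => ContDiff.mul (ContDiff.pow ?_ _) ((contDiff_symbol _).comp contDiff_snd)
  exact Complex.ofRealCLM.contDiff.comp contDiff_fst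

theorem rescaledSymbol_smul (hP : P.totalDegree = α) (t : ℝ) (ξ : Space n) :
    rescaledSymbol P α (t, t • ξ) = (t : ℂ) ^ α * symbol P ξ := by
  rw [symbol_eq_sum_homogeneousComponent hP, Finset.mul_sum, rescaledSymbol]
  refine Finset.sum_congr rfl fun j hj => ?_
  simp only
  rw [symbol_smul_of_isHomogeneous (MvPolynomial.homogeneousComponent_isHomogeneous j P),
    ← mul_assoc, ← pow_add, Nat.sub_add_cancel (Finset.mem_range_succ_iff.1 hj)]

theorem rescaledSymbol_zero (P : MvPolynomial (Fin n) ℂ) (α : ℕ) (ξ : Space n) :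
    rescaledSymbol P α (0, ξ) = principalSymbol P α ξ := by
  rw [rescaledSymbol, Finset.sum_range_succ, Finset.sum_eq_zero, zero_add]
  · simp [principalSymbol]
  · intro j hj
    have : α - j ≠ 0 := by
      have := Finset.mem_range.1 hj
      omega
    simp [this]

/-- Ellipticity covers `t = 0`; for `t ≠ 0` the bound on `p` is invariant under the rescaling. This
uniformity is what allows division by the rescaled symbol up to `t = 0`. -/
theorem exists_le_norm_rescaledSymbol (hP : P.totalDegree = α) (hell : IsElliptic P α) {c₁ : ℝ}
    (hc₁ : 0 < c₁) (hlower : ∀ ξ : Space n, c₁ * ‖ξ‖ ^ α ≤ ‖symbol P ξ‖) :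
    ∃ c > 0, ∀ z : ℝ × Space n, c * ‖z.2‖ ^ α ≤ ‖rescaledSymbol P α z‖ := by
  obtain ⟨c₀, hc₀, h₀⟩ := hell
  refine ⟨min c₀ c₁, lt_min hc₀ hc₁, fun ⟨t, η⟩ => ?_⟩
  rcases eq_or_ne t 0 with rfl | ht
  · rw [rescaledSymbol_zero]
    exact le_trans (by gcongr; exact min_le_left _ _) (h₀ η)
  · have hη : η = t • (t⁻¹ • η) := by rw [smul_smul, mul_inv_cancel₀ ht, one_smul]
    conv_rhs => rw [hη]
    rw [rescaledSymbol_smul hP, norm_mul, norm_pow, Complex.norm_real]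
    have h1 := hlower (t⁻¹ • η)
    rw [norm_smul, norm_inv, mul_pow, inv_pow] at h1
    have ht' : 0 < ‖t‖ ^ α := pow_pos (norm_pos_iff.2 ht) _
    calc min c₀ c₁ * ‖η‖ ^ α ≤ c₁ * ‖η‖ ^ α := by gcongr; exact min_le_right _ _
      _ = ‖t‖ ^ α * (c₁ * ((‖t‖ ^ α)⁻¹ * ‖η‖ ^ α)) := by field_simp
      _ ≤ _ := by gcongr

/-- The pieces of the dyadic decomposition of `1 / p` away from the origin, at unit scale. -/
noncomputable def dyadicPiece (P : MvPolynomial (Fin n) ℂ) (α : ℕ) (χ : Space n → ℝ) (z : ℝ × Space n) : ℂ :=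
  ((χ ((1 / 2 : ℝ) • z.2) - χ z.2 : ℝ) : ℂ) * (rescaledSymbol P α z)⁻¹

theorem contDiff_dyadicPiece (hP : P.totalDegree = α) (hell : IsElliptic P α) {c₁ : ℝ}
    (hc₁ : 0 < c₁) (hlower : ∀ ξ : Space n, c₁ * ‖ξ‖ ^ α ≤ ‖symbol P ξ‖) {χ : Space n → ℝ}
    (hχ : ContDiff ℝ ∞ χ) (hχ1 : ∀ ξ, ‖ξ‖ ≤ 1 / 2 → χ ξ = 1) :
    ContDiff ℝ ∞ (dyadicPiece P α χ) := by
  obtain ⟨c, hc, hcz⟩ := exists_le_norm_rescaledSymbol hP hell hc₁ hlower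
  rw [contDiff_iff_contDiffAt]
  intro z
  -- Near the possible zero of the denominator the cutoff difference vanishes identically.
  by_cases hz : ‖z.2‖ < 1 / 2
  · have : dyadicPiece P α χ =ᶠ[nhds z] fun _ => 0 := by
      have hopen : IsOpen {w : ℝ × Space n | ‖w.2‖ < 1 / 2} :=
        isOpen_lt (by fun_prop) continuous_const
      filter_upwards [hopen.mem_nhds hz] with w hw
      have hw : ‖w.2‖ < 1 / 2 := hw
      have hw' : ‖(1 / 2 : ℝ) • w.2‖ ≤ 1 / 2 := by
        rw [norm_smul, Real.norm_of_nonneg (by norm_num)]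
        linarith
      rw [dyadicPiece, hχ1 _ hw.le, hχ1 _ hw']
      simp
    exact contDiffAt_const.congr_of_eventuallyEq this
  · have hne : rescaledSymbol P α z ≠ 0 := by
      rw [← norm_pos_iff]
      refine lt_of_lt_of_le ?_ (hcz z)
      have : 0 < ‖z.2‖ := by linarith
      positivity
    refine ContDiffAt.mul ?_ ((contDiff_rescaledSymbol P α).contDiffAt.inv hne)
    have h1 : ContDiff ℝ ∞ fun z : ℝ × Space n => χ ((1 / 2 : ℝ) • z.2) - χ z.2 :=
      (hχ.comp (contDiff_snd.const_smul _)).sub (hχ.comp contDiff_snd)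
    exact (Complex.ofRealCLM.contDiff.comp h1).contDiffAt

theorem dyadicPiece_eq_zero {χ : Space n → ℝ} (hχ0 : ∀ ξ, 1 ≤ ‖ξ‖ → χ ξ = 0) (t : ℝ) (ξ : Space n)
    (hξ : 2 ≤ ‖ξ‖) : dyadicPiece P α χ (t, ξ) = 0 := by
  have h1 : χ ((1 / 2 : ℝ) • ξ) = 0 := by
    refine hχ0 _ ?_
    rw [norm_smul, Real.norm_of_nonneg (by norm_num)]
    linarith
  rw [dyadicPiece, h1, hχ0 ξ (by linarith)]
  simp

/-- The dyadic pieces add up to `(1 - χ) / p`. -/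
theorem tendsto_sum_dyadicPiece (hP : P.totalDegree = α) {χ : Space n → ℝ}
    (hχ1 : ∀ ξ, ‖ξ‖ ≤ 1 / 2 → χ ξ = 1) (ξ : Space n) :
    Filter.Tendsto (fun N => ∑ j ∈ Finset.range N, (((1 / 2 : ℝ) ^ j : ℝ) : ℂ) ^ α *
      dyadicPiece P α χ ((1 / 2 : ℝ) ^ j, (1 / 2 : ℝ) ^ j • ξ)) Filter.atTop
      (nhds ((1 - χ ξ) * (symbol P ξ)⁻¹)) := by
  have hterm (j : ℕ) : (((1 / 2 : ℝ) ^ j : ℝ) : ℂ) ^ α *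
      dyadicPiece P α χ ((1 / 2 : ℝ) ^ j, (1 / 2 : ℝ) ^ j • ξ) =
      ((χ ((1 / 2 : ℝ) ^ (j + 1) • ξ) : ℂ) - χ ((1 / 2 : ℝ) ^ j • ξ)) * (symbol P ξ)⁻¹ := by
    have ht : (((1 / 2 : ℝ) ^ j : ℝ) : ℂ) ≠ 0 := by
      exact_mod_cast (by positivity : ((1 / 2 : ℝ) ^ j) ≠ 0)
    rw [dyadicPiece]
    simp only
    rw [rescaledSymbol_smul hP, smul_smul, ← pow_succ', mul_inv]
    push_cast at ht ⊢
    field_simp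
  simp only [hterm, ← Finset.sum_mul]
  refine Filter.Tendsto.mul_const _ ?_
  have htel (N : ℕ) := Finset.sum_range_sub (fun j => (χ ((1 / 2 : ℝ) ^ j • ξ) : ℂ)) N
  simp only [htel, pow_zero, one_smul]
  refine Filter.Tendsto.sub_const ?_ _
  refine tendsto_const_nhds.congr' ?_
  have hlim : Filter.Tendsto (fun N : ℕ => ‖(1 / 2 : ℝ) ^ N • ξ‖) Filter.atTop (nhds 0) := by
    have := (tendsto_pow_atTop_nhds_zero_of_lt_one (by norm_num : (0 : ℝ) ≤ 1 / 2)
      (by norm_num)).smul_const ξ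
    simpa using this.norm
  filter_upwards [hlim.eventually (ge_mem_nhds (by norm_num : (0 : ℝ) < 1 / 2))] with N hN
  rw [hχ1 _ hN, Complex.ofReal_one]

/-- The part of the fundamental solution coming from high frequencies is integrable, and bounded
away from the origin. -/
theorem exists_integrable_fourier_eq_high (hα0 : 0 < α) (hP : P.totalDegree = α)
    (hell : IsElliptic P α) {c₁ : ℝ}
    (hc₁ : 0 < c₁) (hlower : ∀ ξ : Space n, c₁ * ‖ξ‖ ^ α ≤ ‖symbol P ξ‖) {χ : Space n → ℝ}
    (hχ : ContDiff ℝ ∞ χ) (hχ1 : ∀ ξ, ‖ξ‖ ≤ 1 / 2 → χ ξ = 1) (hχ0 : ∀ ξ, 1 ≤ ‖ξ‖ → χ ξ = 0) :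
    ∃ K : Space n → ℂ, Integrable K ∧ (∃ C, ∀ x, 1 ≤ ‖x‖ → ‖K x‖ ≤ C) ∧
      ∀ ξ, 𝓕 K ξ = (1 - χ ξ) * (symbol P ξ)⁻¹ := by
  have hG := contDiff_dyadicPiece hP hell hc₁ hlower hχ hχ1
  have hG0 := dyadicPiece_eq_zero (P := P) (α := α) hχ0
  have hcs (t : ℝ) : HasCompactSupport fun ξ => dyadicPiece P α χ (t, ξ) :=
    HasCompactSupport.intro (isCompact_closedBall (0 : Space n) 2) fun ξ hξ =>
      hG0 t ξ (by simpa using (not_le.1 (mt mem_closedBall_zero_iff.2 hξ)).le)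
  let g : ℝ → 𝓢(Space n, ℂ) := fun t =>
    (hcs t).toSchwartzMap (hG.comp (contDiff_const.prodMk contDiff_id))
  have hg (t ξ) : g t ξ = dyadicPiece P α χ (t, ξ) := rfl
  let h : ℝ → 𝓢(Space n, ℂ) := fun t => 𝓕⁻ (g t)
  -- The weight `|x|^n` is chosen to cancel the factor `T^{-n}` of the rescaled kernels when `|x| ≥
  -- 1`.
  let q : Seminorm ℂ 𝓢(Space n, ℂ) :=
    (SchwartzMap.seminorm ℂ n 0).comp (fourierInvCLM ℂ 𝓢(Space n, ℂ)).toLinearMap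
  have hq : Continuous q := ((schwartz_withSeminorms ℂ (Space n) ℂ).continuous_seminorm (n, 0)).comp
    (fourierInvCLM ℂ 𝓢(Space n, ℂ)).continuous
  obtain ⟨B, hB0, hB⟩ := exists_bound_seminorm_slice hG hG0 hg q hq
  obtain ⟨D, hD0, hD⟩ := exists_bound_seminorm_slice hG hG0 hg
    ((normSeminorm ℂ (Lp ℂ 1 (volume : Measure (Space n)))).comp
      (toLpCLM ℂ ℂ 1 volume ∘L fourierInvCLM ℂ 𝓢(Space n, ℂ)).toLinearMap)
    (continuous_norm.comp (toLpCLM ℂ ℂ 1 volume ∘L fourierInvCLM ℂ 𝓢(Space n, ℂ)).continuous)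
  have hdecay (t) (ht : t ∈ Set.Icc (0 : ℝ) 1) (x) : ‖x‖ ^ n * ‖h t x‖ ≤ B :=
    (SchwartzMap.norm_pow_mul_le_seminorm ℂ (h t) n x).trans (hB t ht)
  have hL1 (t) (ht : t ∈ Set.Icc (0 : ℝ) 1) : ∫ x, ‖h t x‖ ≤ D := by
    rw [← SchwartzMap.norm_toLp_one]
    exact hD t ht
  let T : ℕ → ℝ := fun j => (1 / 2) ^ j
  have hT0 (j : ℕ) : 0 < T j := by positivity
  have hTI (j : ℕ) : T j ∈ Set.Icc (0 : ℝ) 1 :=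
    ⟨(hT0 j).le, pow_le_one₀ (by norm_num) (by norm_num)⟩
  have hTα : Summable fun j => T j ^ α := by
    have : (fun j => T j ^ α) = fun j => ((1 / 2 : ℝ) ^ α) ^ j := by
      ext j
      simp only [T]
      rw [← pow_mul, ← pow_mul, mul_comm]
    rw [this]
    exact summable_geometric_of_lt_one (by positivity)
      (pow_lt_one₀ (by norm_num) (by norm_num) hα0.ne')
  -- The inverse transform of the `j`-th shell: its `L¹` norm scales as `T^α`, summable since `α >
  -- 0`.
  let F : ℕ → Space n → ℂ := fun j x => ((T j ^ α * (T j ^ n)⁻¹ : ℝ) : ℂ) * h (T j) ((T j)⁻¹ • x)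
  have hFint (j : ℕ) : Integrable (F j) :=
    ((h (T j)).integrable.comp_smul (inv_ne_zero (hT0 j).ne')).const_mul _
  have hFnorm (j : ℕ) (x : Space n) :
      ‖F j x‖ = T j ^ α * (T j ^ n)⁻¹ * ‖h (T j) ((T j)⁻¹ • x)‖ := by
    have := hT0 j
    rw [norm_mul, Complex.norm_real, Real.norm_of_nonneg (by positivity)]
  have hFL1 (j : ℕ) : ∫ x, ‖F j x‖ ≤ T j ^ α * D := by
    have := hT0 j
    simp only [hFnorm]
    rw [integral_const_mul, Measure.integral_comp_inv_smul volume (fun x => ‖h (T j) x‖),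
      finrank_euclideanSpace, Fintype.card_fin, abs_of_pos (by positivity), smul_eq_mul]
    calc T j ^ α * (T j ^ n)⁻¹ * (T j ^ n * ∫ x, ‖h (T j) x‖) = T j ^ α * ∫ x, ‖h (T j) x‖ := by
          field_simp
      _ ≤ _ := by gcongr; exact hL1 _ (hTI j)
  have hFsum : Summable fun j => ∫ x, ‖F j x‖ :=
    Summable.of_nonneg_of_le (fun j => integral_nonneg fun x => norm_nonneg _) hFL1
      (hTα.mul_right D)
  refine ⟨fun x => ∑' j, F j x, integrable_tsum_of_summable_integral_norm hFint hFsum,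
    ⟨∑' j, T j ^ α * B, fun x hx => ?_⟩, fun ξ => ?_⟩
  · refine tsum_of_norm_bounded (hTα.mul_right B).hasSum fun j => ?_
    have hTj := hT0 j
    have h1 := hdecay (T j) (hTI j) ((T j)⁻¹ • x)
    rw [norm_smul, norm_inv, Real.norm_of_nonneg hTj.le, mul_pow, inv_pow] at h1
    rw [hFnorm, mul_assoc]
    gcongr
    refine le_trans ?_ h1
    rw [mul_assoc]
    gcongr
    exact le_mul_of_one_le_left (norm_nonneg _) (one_le_pow₀ hx)
  · have hFour (j : ℕ) : 𝓕 (F j) ξ = (((1 / 2 : ℝ) ^ j : ℝ) : ℂ) ^ α *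
        dyadicPiece P α χ ((1 / 2 : ℝ) ^ j, (1 / 2 : ℝ) ^ j • ξ) := by
      have hTj : ((T j : ℝ) : ℂ) ≠ 0 := by exact_mod_cast (hT0 j).ne'
      have hinv : 𝓕 (h (T j) : Space n → ℂ) = g (T j) := by
        rw [← SchwartzMap.fourier_coe, FourierTransform.fourier_fourierInv_eq]
      have hc : 𝓕 (F j) ξ = ((T j ^ α * (T j ^ n)⁻¹ : ℝ) : ℂ) *
          𝓕 (fun x => h (T j) ((T j)⁻¹ • x)) ξ := by
        rw [Real.fourier_eq, Real.fourier_eq, ← integral_const_mul]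
        refine integral_congr_ae (.of_forall fun x => ?_)
        simp only [F, Circle.smul_def, smul_eq_mul]
        ring
      rw [hc, fourier_comp_inv_smul _ (hT0 j), hinv, hg]
      push_cast
      field_simp
      simp [T]
    -- Absolute convergence in `L¹` allows the transform to be taken termwise; the limit is then
    -- identified by the telescoping sum of cutoffs.
    have hsum := hasSum_integral_of_summable_integral_norm
      (F := fun j x => Real.fourierChar (-inner ℝ x ξ) • F j x)
      (fun j => (Real.fourierIntegral_convergent_iff ξ).2 (hFint j))
      (by simpa only [Circle.norm_smul] using hFsum)
    have hlim := hsum.tendsto_sum_nat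
    simp only [← Real.fourier_eq, hFour] at hlim
    rw [← tendsto_nhds_unique hlim (tendsto_sum_dyadicPiece hP hχ1 ξ), Real.fourier_eq]
    refine integral_congr_ae (.of_forall fun x => ?_)
    simp only [Circle.smul_def, smul_eq_mul, tsum_mul_left]

end HighFrequency

/-! ### Assembling the fundamental solution. -/

section Construction

/-- On `s` one has `|K|^q ≤ C^{q-1}|K|`. -/
theorem memLp_restrict_of_integrable_of_bound {X : Type*} [MeasurableSpace X] {μ : Measure X}
    {K : X → ℂ} (hK : Integrable K μ) {s : Set X} (hs : MeasurableSet s) {C : ℝ}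
    (hC : ∀ x ∈ s, ‖K x‖ ≤ C) {q : ℝ} (hq : 1 ≤ q) :
    MemLp K (ENNReal.ofReal q) (μ.restrict s) := by
  refine ⟨hK.aestronglyMeasurable.restrict, ?_⟩
  have hq0 : 0 < q := by linarith
  rw [eLpNorm_lt_top_iff_lintegral_rpow_enorm_lt_top (by simpa using hq0) (by simp),
    ENNReal.toReal_ofReal hq0.le]
  calc ∫⁻ x in s, ‖K x‖ₑ ^ q ∂μ ≤ ∫⁻ x in s, ENNReal.ofReal C ^ (q - 1) * ‖K x‖ₑ ∂μ := by
        refine setLIntegral_mono' hs fun x hx => ?_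
        have h1 : ‖K x‖ₑ ^ q = ‖K x‖ₑ ^ (q - 1) * ‖K x‖ₑ := by
          conv_rhs => rw [← ENNReal.rpow_one ‖K x‖ₑ, ← ENNReal.rpow_mul, one_mul,
            ← ENNReal.rpow_add_of_nonneg _ _ (by linarith) zero_le_one]
          ring_nf
        have h2 : ‖K x‖ₑ ≤ ENNReal.ofReal C := by
          rw [← ofReal_norm]
          exact ENNReal.ofReal_le_ofReal (hC x hx)
        rw [h1]
        gcongr
    _ ≤ ∫⁻ x, ENNReal.ofReal C ^ (q - 1) * ‖K x‖ₑ ∂μ := setLIntegral_le_lintegral _ _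
    _ = ENNReal.ofReal C ^ (q - 1) * ∫⁻ x, ‖K x‖ₑ ∂μ :=
        lintegral_const_mul' _ _ (ENNReal.rpow_ne_top_of_nonneg (by linarith) (by simp))
    _ < ⊤ := ENNReal.mul_lt_top
        (ENNReal.rpow_lt_top_of_nonneg (by linarith) (by simp)) hK.2

variable {n α : ℕ} {P : MvPolynomial (Fin n) ℂ}

theorem norm_fourier_le_integral_norm (f : Space n → ℂ) (x : Space n) :
    ‖𝓕 f x‖ ≤ ∫ y, ‖f y‖ := by
  rw [Real.fourier_eq]
  refine (norm_integral_le_integral_norm _).trans_eq ?_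
  simp only [Circle.norm_smul]

theorem integral_schwartz_mul_fourierInv {f : Space n → ℂ} (hf : Integrable f)
    (φ : 𝓢(Space n, ℂ)) :
    ∫ x, (𝓕 φ : 𝓢(Space n, ℂ)) x * 𝓕⁻ f x = ∫ x, φ x * f x := by
  have hneg : Integrable (fun x => f (-x)) := hf.comp_neg
  rw [Real.fourierInv_eq_fourier_comp_neg, ← integral_fourier_schwartz_mul hneg,
    ← integral_neg_eq_self]
  refine integral_congr_ae (.of_forall fun x => ?_)
  have h1 : (𝓕 (𝓕 φ) : 𝓢(Space n, ℂ)) (-x) = φ x := by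
    rw [SchwartzMap.fourier_coe, ← Real.fourierInv_eq_fourier_neg, ← SchwartzMap.fourierInv_coe,
      FourierTransform.fourierInv_fourier_eq]
  simp [h1]

theorem integrable_schwartz_mul (φ : 𝓢(Space n, ℂ)) {f : Space n → ℂ} (hf : Integrable f) :
    Integrable fun x => φ x * f x :=
  hf.bdd_mul φ.continuous.aestronglyMeasurable
    (.of_forall fun x => SchwartzMap.norm_le_seminorm ℂ φ x)

theorem integrable_schwartz_mul_of_bound (φ : 𝓢(Space n, ℂ)) {f : Space n → ℂ} (hf : Continuous f)
    {C : ℝ} (hC : ∀ x, ‖f x‖ ≤ C) : Integrable fun x => φ x * f x :=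
  φ.integrable.mul_bdd hf.aestronglyMeasurable (.of_forall hC)

/-- If `𝓕 K₁ + f = g` with `K₁` and `f` integrable, then `K₁ + 𝓕⁻ f` defines a tempered
distribution whose Fourier transform is `g`. -/
theorem exists_isGivenBy_add_fourierInv {K₁ f g : Space n → ℂ} (hK₁ : Integrable K₁)
    (hf : Integrable f) (hg : LocallyIntegrable g) (hgf : ∀ ξ, g ξ = 𝓕 K₁ ξ + f ξ) :
    ∃ T : 𝓢'(Space n, ℂ), IsGivenBy T (fun x => K₁ x + 𝓕⁻ f x) ∧ IsGivenBy (𝓕 T) g := by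
  have hcont : Continuous (𝓕⁻ f) := by
    rw [Real.fourierInv_eq_fourier_comp_neg]
    exact continuous_fourier_of_integrable hf.comp_neg
  have hbound (x : Space n) : ‖𝓕⁻ f x‖ ≤ ∫ y, ‖f y‖ := by
    rw [Real.fourierInv_eq_fourier_neg]
    exact norm_fourier_le_integral_norm f _
  let A : Lp ℂ 1 (volume : Measure (Space n)) := (memLp_one_iff_integrable.2 hK₁).toLp K₁
  have hB := memLp_top_of_bound hcont.aestronglyMeasurable (μ := volume) _ (.of_forall hbound)
  let B : Lp ℂ ⊤ (volume : Measure (Space n)) := hB.toLp (𝓕⁻ f)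
  have hA' (φ : 𝓢(Space n, ℂ)) : Lp.toTemperedDistribution A φ = ∫ x, φ x * K₁ x := by
    rw [Lp.toTemperedDistribution_apply]
    refine integral_congr_ae ?_
    filter_upwards [MemLp.coeFn_toLp (memLp_one_iff_integrable.2 hK₁)] with x hx
    rw [smul_eq_mul, hx]
  have hB' (φ : 𝓢(Space n, ℂ)) : Lp.toTemperedDistribution B φ = ∫ x, φ x * 𝓕⁻ f x := by
    rw [Lp.toTemperedDistribution_apply]
    refine integral_congr_ae ?_
    filter_upwards [hB.coeFn_toLp] with x hx
    rw [smul_eq_mul, hx]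
  let T : 𝓢'(Space n, ℂ) := Lp.toTemperedDistribution A + Lp.toTemperedDistribution B
  have hT (φ : 𝓢(Space n, ℂ)) : T φ = (∫ x, φ x * K₁ x) + ∫ x, φ x * 𝓕⁻ f x := by
    rw [← hA', ← hB']
    rfl
  refine ⟨T, ⟨hK₁.locallyIntegrable.add hcont.locallyIntegrable, fun φ => ?_⟩, hg, fun φ => ?_⟩
  · have h1 := integrable_schwartz_mul φ hK₁
    have h2 := integrable_schwartz_mul_of_bound φ hcont hbound
    simp only [mul_add]
    exact ⟨h1.add h2, by rw [hT, integral_add h1 h2]⟩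
  · have h1 := integrable_schwartz_mul_of_bound φ (continuous_fourier_of_integrable hK₁)
      (norm_fourier_le_integral_norm K₁)
    have h2 := integrable_schwartz_mul φ hf
    simp only [hgf, mul_add]
    refine ⟨h1.add h2, ?_⟩
    rw [integral_add h1 h2, TemperedDistribution.fourier_apply, hT,
      integral_fourier_schwartz_mul hK₁, integral_schwartz_mul_fourierInv hf]

theorem ae_symbol_ne_zero (hn : 0 < n) {c₁ : ℝ} (hc₁ : 0 < c₁)
    (hlower : ∀ ξ : Space n, c₁ * ‖ξ‖ ^ α ≤ ‖symbol P ξ‖) : ∀ᵐ ξ : Space n, symbol P ξ ≠ 0 := by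
  have : Nonempty (Fin n) := ⟨⟨0, hn⟩⟩
  filter_upwards [Measure.ae_ne volume (0 : Space n)] with ξ hξ
  rw [← norm_pos_iff]
  refine lt_of_lt_of_le ?_ (hlower ξ)
  have := norm_pos_iff.2 hξ
  positivity

theorem measurable_symbol_inv (P : MvPolynomial (Fin n) ℂ) :
    Measurable fun ξ : Space n => (symbol P ξ)⁻¹ :=
  (continuous_symbol P).measurable.inv

theorem locallyIntegrable_symbol_inv (hαn : α < n) {c₁ : ℝ} (hc₁ : 0 < c₁)
    (hlower : ∀ ξ : Space n, c₁ * ‖ξ‖ ^ α ≤ ‖symbol P ξ‖) :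
    LocallyIntegrable (fun ξ : Space n => (symbol P ξ)⁻¹) volume := by
  have : Nonempty (Fin n) := ⟨⟨0, by omega⟩⟩
  refine locallyIntegrable_of_norm_le_rpow (C := c₁⁻¹) (α := α) (by simp; omega)
    (by simpa using hαn) ?_ (measurable_symbol_inv P).aestronglyMeasurable
  filter_upwards [Measure.ae_ne volume (0 : Space n)] with ξ hξ
  have := norm_pos_iff.2 hξ
  rw [norm_inv, Real.rpow_neg (norm_nonneg _), Real.rpow_natCast, ← mul_inv]
  exact inv_anti₀ (by positivity) (hlower ξ)

theorem exists_isFundamentalSolution_memLp (hα : (n : ℝ) / 2 ≤ α) (hαn : α < n)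
    (hP : P.totalDegree = α) (hnh : ¬ P.IsHomogeneous α) (hell : IsElliptic P α) {c₁ : ℝ}
    (hc₁ : 0 < c₁) (hlower : ∀ ξ : Space n, c₁ * ‖ξ‖ ^ α ≤ ‖symbol P ξ‖) :
    ∃ K : Space n → ℂ, IsFundamentalSolution P K ∧
      MemLp K (ENNReal.ofReal ((n : ℝ) / ((n : ℝ) - (α : ℝ))))
        (volume.restrict {x : Space n | 1 ≤ ‖x‖}) := by
  have hnR : (0 : ℝ) < n := by
    have : 0 < n := by omega
    exact_mod_cast this
  have hαR : (0 : ℝ) < α := by linarith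
  have hα0 : 0 < α := by exact_mod_cast hαR
  have hαnR : (α : ℝ) < n := by exact_mod_cast hαn
  have hsub : (0 : ℝ) < n - α := by linarith
  let b : ContDiffBump (0 : Space n) := ⟨1 / 2, 1, by norm_num, by norm_num⟩
  have hb1 (ξ : Space n) (hξ : ‖ξ‖ ≤ 1 / 2) : b ξ = 1 :=
    b.one_of_mem_closedBall (by simpa [b] using hξ)
  have hb0 (ξ : Space n) (hξ : 1 ≤ ‖ξ‖) : b ξ = 0 := b.zero_of_le_dist (by simpa [b] using hξ)
  obtain ⟨K₁, hK₁, ⟨C, hC⟩, hK₁F⟩ :=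
    exists_integrable_fourier_eq_high hα0 hP hell hc₁ hlower b.contDiff hb1 hb0
  set f : Space n → ℂ := fun ξ => (b ξ : ℂ) * (symbol P ξ)⁻¹ with hf
  have hfm : Measurable f :=
    (Complex.measurable_ofReal.comp b.continuous.measurable).mul (measurable_symbol_inv P)
  have hloc := locallyIntegrable_symbol_inv (P := P) hαn hc₁ hlower
  have hfint : Integrable f := by
    simpa [hf] using! hloc.integrable_smul_left_of_hasCompactSupport b.continuous
      b.hasCompactSupport
  obtain ⟨T, hT, hT𝓕⟩ := exists_isGivenBy_add_fourierInv (g := fun ξ => (symbol P ξ)⁻¹)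
    hK₁ hfint hloc fun ξ => by rw [hK₁F, hf]; ring
  refine ⟨_, ⟨T, hT, applyOp_eq_delta hT𝓕 (ae_symbol_ne_zero (by omega) hc₁ hlower), hT𝓕⟩, ?_⟩
  have hconj : (n / α : ℝ).HolderConjugate (n / (n - α)) := by
    rw [Real.holderConjugate_iff]
    refine ⟨(one_lt_div hαR).2 hαnR, ?_⟩
    rw [inv_div, inv_div]
    field_simp
    ring
  refine (memLp_restrict_of_integrable_of_bound hK₁
    (measurableSet_le measurable_const measurable_norm) hC hconj.symm.lt.le).add
    ((memLp_fourierInv hfm hfint hconj ?_ ?_).mono_measure Measure.restrict_le_self)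
  -- The condition `n/α ≤ 2` of Hausdorff–Young is exactly `α ≥ n/2`.
  · rw [div_le_iff₀ hαR]
    linarith
  · refine lt_of_le_of_lt ?_
      (lintegral_ball_symbol_rpow_neg_lt_top hα0 hαn hP hnh hc₁ hlower)
    rw [← lintegral_indicator Metric.isOpen_ball.measurableSet]
    refine lintegral_mono fun ξ => ?_
    have hexp : (0 : ℝ) < n / α := by positivity
    by_cases hξ : ξ ∈ Metric.ball (0 : Space n) 1
    · rw [Set.indicator_of_mem hξ]
      -- Where `p` vanishes, the convention `0⁻¹ = 0` makes `f` zero.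
      rcases eq_or_ne (symbol P ξ) 0 with h0 | h0
      · simp [hf, h0, Real.zero_rpow hexp.ne']
      · rw [← ofReal_norm, ENNReal.ofReal_rpow_of_pos (norm_pos_iff.2 h0),
          Real.rpow_neg (norm_nonneg _), ← Real.inv_rpow (norm_nonneg _)]
        refine ENNReal.ofReal_le_ofReal ?_
        gcongr
        rw [hf, norm_mul, norm_inv, Complex.norm_real, Real.norm_of_nonneg b.nonneg]
        exact mul_le_of_le_one_left (by positivity) b.le_one
    · rw [mem_ball_zero_iff, not_lt] at hξ
      simp [hf, hb0 ξ hξ, Real.zero_rpow hexp.ne']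

end Construction

end EllipticOperator

theorem theorem11 (n α : ℕ) (hα : (n : ℝ) / 2 ≤ (α : ℝ)) (hαn : α < n)
    (P : MvPolynomial (Fin n) ℂ)
    (horder : P.totalDegree = α)
    (hnonhom : ¬ P.IsHomogeneous α)
    (hell : EllipticOperator.IsElliptic P α)
    (c₁ : ℝ) (hc₁ : 0 < c₁)
    (hlower : ∀ ξ : EllipticOperator.Space n,
      c₁ * ‖ξ‖ ^ α ≤ ‖EllipticOperator.symbol P ξ‖) :
    (∃ K : EllipticOperator.Space n → ℂ, EllipticOperator.IsFundamentalSolution P K) ∧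
    ∀ K : EllipticOperator.Space n → ℂ, EllipticOperator.IsFundamentalSolution P K →
      MemLp K (ENNReal.ofReal ((n : ℝ) / ((n : ℝ) - (α : ℝ))))
        (volume.restrict {x : EllipticOperator.Space n | 1 ≤ ‖x‖}) := by
  obtain ⟨K₀, hK₀, hmem⟩ := EllipticOperator.exists_isFundamentalSolution_memLp hα hαn horder
    hnonhom hell hc₁ hlower
  -- Uniqueness up to null sets carries the bound from the constructed kernel to every
  -- representative.
  exact ⟨⟨K₀, hK₀⟩, fun K hK => hmem.ae_eq (ae_restrict_of_ae (hK₀.ae_eq hK))⟩
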